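/- For an integer partition $\lambda=(\lambda_1\ge\lambda_2\ge\cdots)$ with $\ell(\lambda)$ nonzero parts (and $\lambda_i=0$ for $i>\ell(\lambda)$) and complex $a,b,c,d$ put $$\omega(\lambda)=a^{\sum_{i\ge1}\lceil\lambda_{2i-1}/2\rceil}\,b^{\sum_{i\ge1}\lfloor\lambda_{2i-1}/2\rfloor}\,c^{\sum_{i\ge1}\lceil\lambda_{2i}/2\rceil}\,d^{\sum_{i\ge1}\lfloor\lambda_{2i}/2\rfloor}.$$ A partition is strict if its parts are pairwise distinct. For $z\in\mathbb C$ and $N\ge 0$ let $\Psi_N=\sum\omega(\mu)z^{\ell(\mu)}$, summed over the strict partitions $\mu$ all of whose parts are at most $N$, and put $X_N=\Psi_{2N}$, $Y_N=\Psi_{2N+1}$. Write $(x;q)_n=\prod_{k=0}^{n-1}(1-xq^k)$, $(x;q)_\infty=\prod_{k\ge0}(1-xq^k)$, $(x_1,\dots,x_m;q)_\infty=\prod_j(x_j;q)_\infty$, and $${}_2\phi_1(a_1,a_2;b_1;q,x)=\sum_{n\ge0}\frac{(a_1;q)_n(a_2;q)_n}{(q;q)_n(b_1;q)_n}x^n .$$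 Set $q=abcd$ and $$s^X_0={}_2\phi_1(z^2q,-abd;-az^2q;q,-abc),\qquad s^X_1=\frac{ab(1-z^2q)(1-acz^2)}{1+az^2q}\,{}_2\phi_1(z^2q^2,-abd;-az^2q^2;q,-abc),$$ $$s^Y_0={}_2\phi_1(z^2q,-abd;-aq^2z^2;q,-abc),\qquad s^Y_1=\frac{ab(1-z^2q)(1-acqz^2)}{1+aq^2z^2}\,{}_2\phi_1(z^2q^2,-abd;-aq^3z^2;q,-abc)$$ (here $-abd=-c^{-1}q$ when $c\ne0$). Assume $|a|,|b|,|c|,|d|<1$. Then: (1) For every $z\in\mathbb C$ the sum $\sum_\mu\omega(\mu)z^{\ell(\mu)}$ over all strict partitions converges absolutely. (2) If $1+az^2q^k\neq0$ for all $k\ge1$, then $$\sum_{\mu\ \mathrm{strict}}\omega(\mu)z^{\ell(\mu)}=\frac{(-abc,-az^2q;q)_\infty}{(ab;q)_\infty}\,\bigl(s^X_0X_1-s^X_1X_0\bigr).$$ (3) If $1+az^2q^k\neq0$ for all $k\ge2$, then $$\sum_{\mu\ \mathrm{strict}}\omega(\mu)z^{\ell(\mu)}=\frac{(-abc,-az^2q^2;q)_\infty}{(ab;q)_\infty}\,\bigl(s^Y_0Y_1-s^Y_1Y_0\bigr).$$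 (4) As $z\to0$, $$\sum_{\mu\ \mathrm{strict}}\omega(\mu)z^{\ell(\mu)}=1+\frac{a(1+b)}{1-ab}z+\frac{abc(1+a+ad+abd)}{(1-ab)(1-q)}z^2+\frac{a^2q(1+b)(1+bc+abc+bq)}{(1-ab)(1-q)(1-abq)}z^3+O(z^4).$$ (5) If $|acz^2|<1$, then the sum over all partitions $\lambda$ converges absolutely and $$\sum_\lambda\omega(\lambda)z^{\ell(\lambda)}=\frac{(-abc,-az^2q;q)_\infty}{(ab,acz^2,z^2q;q)_\infty}\bigl(s^X_0X_1-s^X_1X_0\bigr)=\frac{(-abc,-az^2q^2;q)_\infty}{(ab,acz^2,z^2q;q)_\infty}\bigl(s^Y_0Y_1-s^Y_1Y_0\bigr).$$ -/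

import Mathlib

namespace AndrewsStanley

/-- Integer partitions of arbitrary size. -/
abbrev IntPartition : Type := Σ n : ℕ, n.Partition

/-- The length: the number of (nonzero) parts. -/
def length (p : IntPartition) : ℕ := p.2.parts.card

/-- The `i`-th part `λ_i`, for `i ≥ 1`, of `λ₁ ≥ λ₂ ≥ ⋯`, with `λ_i = 0` beyond the length. -/
def part (p : IntPartition) (i : ℕ) : ℕ := (p.2.parts.sort (· ≥ ·)).getD (i - 1) 0

/-- A partition is strict when its parts are pairwise distinct. -/
def IsStrict (p : IntPartition) : Prop := p.2.parts.Nodup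

/-- The strict partitions, of arbitrary size. -/
abbrev StrictPartition : Type := {p : IntPartition // IsStrict p}

/-- The weight `ω(λ) = a^{∑⌈λ_{2i-1}/2⌉} b^{∑⌊λ_{2i-1}/2⌋} c^{∑⌈λ_{2i}/2⌉} d^{∑⌊λ_{2i}/2⌋}`, the sums
over `i ≥ 1`. Parts beyond the length vanish, so `1 ≤ i ≤ ℓ(λ)` suffices; in natural number
division `(m + 1) / 2 = ⌈m/2⌉` and `m / 2 = ⌊m/2⌋`. -/
def weight (a b c d : ℂ) (p : IntPartition) : ℂ :=
  a ^ (∑ i ∈ Finset.Icc 1 (length p), (part p (2 * i - 1) + 1) / 2) *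
  b ^ (∑ i ∈ Finset.Icc 1 (length p), part p (2 * i - 1) / 2) *
  c ^ (∑ i ∈ Finset.Icc 1 (length p), (part p (2 * i) + 1) / 2) *
  d ^ (∑ i ∈ Finset.Icc 1 (length p), part p (2 * i) / 2)

/-- The strict partitions all of whose parts are at most `N`. -/
def strictLE (N : ℕ) : Set IntPartition := {p | IsStrict p ∧ ∀ m ∈ p.2.parts, m ≤ N}

/-- There are finitely many of them, so that the sum in `Psi` is an honest finite sum. -/
theorem strictLE_finite (N : ℕ) : (strictLE N).Finite := by
  have inj : Function.Injective (fun p : IntPartition => p.2.parts) := by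
    rintro ⟨n, p⟩ ⟨m, r⟩ h
    have hnm : n = m := by
      rw [← p.parts_sum, ← r.parts_sum]
      exact congrArg Multiset.sum h
    subst hnm
    have : p = r := Nat.Partition.ext h
    rw [this]
  refine Set.Finite.of_finite_image
    (f := fun p : IntPartition => p.2.parts) ?_ inj.injOn
  refine Set.Finite.subset (Set.finite_Iic (Multiset.range (N + 1))) ?_
  rintro _ ⟨p, ⟨hs, hp⟩, rfl⟩
  refine (Multiset.le_iff_subset hs).2 fun m hm => ?_
  exact Multiset.mem_range.2 (Nat.lt_succ_of_le (hp m hm))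

/-- `Ψ_N(a,b,c,d;z) = ∑ ω(μ) z^{ℓ(μ)}` over the strict partitions with all parts at most `N`. -/
noncomputable def Psi (N : ℕ) (a b c d z : ℂ) : ℂ :=
  ∑ p ∈ (strictLE_finite N).toFinset, weight a b c d p * z ^ length p

/-- `X_N = Ψ_{2N}`. -/
noncomputable def X (N : ℕ) (a b c d z : ℂ) : ℂ := Psi (2 * N) a b c d z

/-- `Y_N = Ψ_{2N+1}`. -/
noncomputable def Y (N : ℕ) (a b c d z : ℂ) : ℂ := Psi (2 * N + 1) a b c d z

/-- The `q`-shifted factorial `(x;q)_n`. -/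
def qFac (x q : ℂ) (n : ℕ) : ℂ := ∏ k ∈ Finset.range n, (1 - x * q ^ k)

/-- The infinite product `(x;q)_∞`. -/
noncomputable def qFacInf (x q : ℂ) : ℂ := ∏' k : ℕ, (1 - x * q ^ k)

/-- The infinite product `(x;q)_∞` converges for `|q| < 1`. -/
theorem multipliable_qFacInf (x : ℂ) {q : ℂ} (hq : ‖q‖ < 1) :
    Multipliable fun k : ℕ => 1 - x * q ^ k := by
  have h : Summable fun k : ℕ => ‖-(x * q ^ k)‖ := by
    simp only [norm_neg, norm_mul, norm_pow]
    exact (summable_geometric_of_lt_one (norm_nonneg q) hq).mul_left _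
  simpa [sub_eq_add_neg] using multipliable_one_add_of_summable h

/-- The basic hypergeometric series `₂φ₁(a₁, a₂; b₁; q, x)`. -/
noncomputable def phi21 (a₁ a₂ b₁ q x : ℂ) : ℂ :=
  ∑' n : ℕ, qFac a₁ q n * qFac a₂ q n / (qFac q q n * qFac b₁ q n) * x ^ n

/-- The series `₂φ₁(a₁, a₂; b₁; q, x)` converges for `|q| < 1` and `|x| < 1`. -/
theorem summable_phi21 (a₁ a₂ b₁ : ℂ) {q x : ℂ} (hq : ‖q‖ < 1) (hx : ‖x‖ < 1) :
    Summable fun n : ℕ => qFac a₁ q n * qFac a₂ q n / (qFac q q n * qFac b₁ q n) * x ^ n := by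
  obtain ⟨r, hxr, hr⟩ := exists_between hx
  have hpow : Filter.Tendsto (fun n : ℕ => q ^ n) Filter.atTop (nhds 0) :=
    tendsto_pow_atTop_nhds_zero_of_norm_lt_one hq
  have h1 : ∀ y : ℂ, Filter.Tendsto (fun n : ℕ => 1 - y * q ^ n) Filter.atTop (nhds 1) := by
    intro y
    simpa using (hpow.const_mul y).const_sub 1
  have hlim : Filter.Tendsto (fun n : ℕ => ‖(1 - a₁ * q ^ n) * (1 - a₂ * q ^ n) /
      ((1 - q * q ^ n) * (1 - b₁ * q ^ n)) * x‖) Filter.atTop (nhds ‖x‖) := by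
    have := ((((h1 a₁).mul (h1 a₂)).div ((h1 q).mul (h1 b₁)) (by norm_num)).mul_const x).norm
    simpa using this
  refine summable_of_ratio_norm_eventually_le hr ?_
  filter_upwards [hlim.eventually (gt_mem_nhds hxr)] with n hn
  have hstep : qFac a₁ q (n + 1) * qFac a₂ q (n + 1) /
      (qFac q q (n + 1) * qFac b₁ q (n + 1)) * x ^ (n + 1) =
      ((1 - a₁ * q ^ n) * (1 - a₂ * q ^ n) / ((1 - q * q ^ n) * (1 - b₁ * q ^ n)) * x) *
      (qFac a₁ q n * qFac a₂ q n / (qFac q q n * qFac b₁ q n) * x ^ n) := by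
    simp only [qFac, Finset.prod_range_succ, pow_succ, div_eq_mul_inv, mul_inv]
    ring
  rw [hstep, norm_mul]
  exact mul_le_mul_of_nonneg_right hn.le (norm_nonneg _)

/-! In the four series below `q = abcd`. Their second numerator parameter `-c⁻¹q` is written in the
division-free form `-abd`, which also makes sense for `c = 0`. -/

/-- `s^X_0 = ₂φ₁(z²q, -c⁻¹q; -az²q; q, -abc)`. -/
noncomputable def sX0 (a b c d z : ℂ) : ℂ :=
  let q := a * b * c * d
  phi21 (z ^ 2 * q) (-(a * b * d)) (-(a * z ^ 2 * q)) q (-(a * b * c))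

/-- `s^X_1 = ab(1-z²q)(1-acz²)/(1+az²q) · ₂φ₁(z²q², -c⁻¹q; -az²q²; q, -abc)`. -/
noncomputable def sX1 (a b c d z : ℂ) : ℂ :=
  let q := a * b * c * d
  a * b * (1 - z ^ 2 * q) * (1 - a * c * z ^ 2) / (1 + a * z ^ 2 * q) *
    phi21 (z ^ 2 * q ^ 2) (-(a * b * d)) (-(a * z ^ 2 * q ^ 2)) q (-(a * b * c))

/-- `s^Y_0 = ₂φ₁(z²q, -c⁻¹q; -aq²z²; q, -abc)`. -/
noncomputable def sY0 (a b c d z : ℂ) : ℂ :=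
  let q := a * b * c * d
  phi21 (z ^ 2 * q) (-(a * b * d)) (-(a * q ^ 2 * z ^ 2)) q (-(a * b * c))

/-- `s^Y_1 = ab(1-z²q)(1-acqz²)/(1+aq²z²) · ₂φ₁(z²q², -c⁻¹q; -aq³z²; q, -abc)`. -/
noncomputable def sY1 (a b c d z : ℂ) : ℂ :=
  let q := a * b * c * d
  a * b * (1 - z ^ 2 * q) * (1 - a * c * q * z ^ 2) / (1 + a * q ^ 2 * z ^ 2) *
    phi21 (z ^ 2 * q ^ 2) (-(a * b * d)) (-(a * q ^ 3 * z ^ 2)) q (-(a * b * c))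

end AndrewsStanley

open AndrewsStanley

namespace AndrewsStanley

open Filter Topology

/-! ### Shifted factorials -/

/-! Deleting the largest part of a partition moves every other part one place, so it exchanges `(a,
b)` with `(c, d)` in the weight. For strict partitions this gives a first-order system linking `Psi
N a b c d z` and `Psi N c d a b z` (`Psi_succ`). Two steps at a time, and after elimination of the
exchanged function, `X` and `Y` satisfy three-term recurrences whose coefficients are polynomials in
`q ^ N` (`X_recurrence`, `Y_recurrence`).

The limit of a solution `V` is found in `limit_of_recurrence`. By a contiguous relation
(`phi21_contiguous`), the functions `φ N = ₂φ₁(uq^N, B; Cq^N; q, x)` solve the adjoint recurrence.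
Hence the Casoratian of `V` and `φ` is multiplied by `1 - C q^N` at each step, so it equals
`(C;q)_N` times its initial value. As `N → ∞`, `φ N` tends to `₁φ₀(B; q, x)`, a quotient of infinite
products by the `q`-binomial theorem (`qBinomial`), while `V` tends to the full sum. Comparing the
two limits expresses the sum through `V 0`, `V 1` and two values of `₂φ₁`; this is (2) and (3).

For (5), inserting or deleting two equal parts leaves the parity of all other places unchanged. All
partitions with parts at most `N` therefore differ from the strict ones by the factor `∏ (1 -
pairWeight)⁻¹` (`tsum_partsLE_mul_prod`), which tends to `1 / ((acz²;q)_∞ (z²q;q)_∞)`.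

For (4), subtracting 2 from all parts larger than 2 gives linear relations between the coefficients
of `z ^ j`. In the limit these relations are triangular in `j` and can be solved one after another.
-/

theorem qFac_zero (x q : ℂ) : qFac x q 0 = 1 := by simp [qFac]

theorem qFac_succ (x q : ℂ) (n : ℕ) : qFac x q (n + 1) = qFac x q n * (1 - x * q ^ n) := by
  simp [qFac, Finset.prod_range_succ]

theorem qFac_succ' (x q : ℂ) (n : ℕ) : qFac x q (n + 1) = (1 - x) * qFac (x * q) q n := by
  simp only [qFac, Finset.prod_range_succ']
  rw [mul_comm]
  congr 1
  · simp
  · exact Finset.prod_congr rfl fun k _ => by ring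

theorem qFac_ne_zero {x q : ℂ} (h : ∀ k : ℕ, 1 - x * q ^ k ≠ 0) (n : ℕ) : qFac x q n ≠ 0 :=
  Finset.prod_ne_zero_iff.2 fun k _ => h k

theorem one_sub_mul_pow_ne_zero {x q : ℂ} (hx : ‖x‖ < 1) (hq : ‖q‖ < 1) (k : ℕ) :
    1 - x * q ^ k ≠ 0 := by
  intro h
  have h1 : ‖x * q ^ k‖ = 1 := by rw [← sub_eq_zero.1 h, norm_one]
  rw [norm_mul, norm_pow] at h1
  have := pow_le_one₀ (n := k) (norm_nonneg q) hq.le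
  nlinarith [norm_nonneg x, norm_nonneg (q ^ k)]

theorem norm_qFac_le (x : ℂ) {q : ℂ} (hq : ‖q‖ < 1) (n : ℕ) :
    ‖qFac x q n‖ ≤ Real.exp (‖x‖ * (1 - ‖q‖)⁻¹) := by
  have hs := (summable_geometric_of_lt_one (norm_nonneg q) hq).mul_left ‖x‖
  calc ‖qFac x q n‖ ≤ ∏ k ∈ Finset.range n, (1 + ‖x‖ * ‖q‖ ^ k) := by
        rw [qFac, norm_prod]
        refine Finset.prod_le_prod (fun _ _ => norm_nonneg _) fun k _ => ?_
        simpa using norm_sub_le (1 : ℂ) (x * q ^ k)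
    _ ≤ Real.exp (∑ k ∈ Finset.range n, ‖x‖ * ‖q‖ ^ k) :=
        Real.prod_one_add_le_exp_sum _ fun k => by positivity
    _ ≤ _ := by
        rw [← tsum_geometric_of_lt_one (norm_nonneg q) hq, ← tsum_mul_left]
        exact Real.exp_le_exp.2 (hs.sum_le_tsum _ fun k _ => by positivity)

/-- Weierstrass's inequality `|∏ (1 - t_k)| ≥ 1 - ∑ |t_k|`. The bound does not depend on `n`; it
keeps the denominators of `₂φ₁` away from zero in `tendsto_phi21`. -/
theorem half_le_norm_qFac {x q : ℂ} (hq : ‖q‖ < 1) (hx : ‖x‖ * (1 - ‖q‖)⁻¹ ≤ 1 / 2) (n : ℕ) :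
    1 / 2 ≤ ‖qFac x q n‖ := by
  have hs := (summable_geometric_of_lt_one (norm_nonneg q) hq).mul_left ‖x‖
  have hle : ∀ n, ∑ k ∈ Finset.range n, ‖x‖ * ‖q‖ ^ k ≤ 1 / 2 := fun n => by
    refine le_trans (hs.sum_le_tsum _ fun k _ => by positivity) ?_
    rwa [tsum_mul_left, tsum_geometric_of_lt_one (norm_nonneg q) hq]
  suffices h : ∀ n, 1 - ∑ k ∈ Finset.range n, ‖x‖ * ‖q‖ ^ k ≤ ‖qFac x q n‖ by
    linarith [h n, hle n]
  intro n
  induction n with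
  | zero => simp [qFac_zero]
  | succ n ih =>
    rw [Finset.sum_range_succ, qFac_succ, norm_mul]
    have h1 : 1 - ‖x‖ * ‖q‖ ^ n ≤ ‖1 - x * q ^ n‖ := by
      simpa using norm_sub_norm_le (1 : ℂ) (x * q ^ n)
    have h2 := hle (n + 1)
    rw [Finset.sum_range_succ] at h2
    have h0 : 0 ≤ ∑ k ∈ Finset.range n, ‖x‖ * ‖q‖ ^ k :=
      Finset.sum_nonneg fun _ _ => by positivity
    have h3 : 0 ≤ ‖x‖ * ‖q‖ ^ n := by positivity
    calc _ ≤ (1 - ∑ k ∈ Finset.range n, ‖x‖ * ‖q‖ ^ k) * (1 - ‖x‖ * ‖q‖ ^ n) := by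
          nlinarith [mul_nonneg h0 h3]
      _ ≤ _ := mul_le_mul ih h1 (by linarith) (norm_nonneg _)

theorem tendsto_qFac (x : ℂ) {q : ℂ} (hq : ‖q‖ < 1) :
    Tendsto (qFac x q) atTop (𝓝 (qFacInf x q)) :=
  (multipliable_qFacInf x hq).hasProd.tendsto_prod_nat

theorem qFacInf_eq_mul (x : ℂ) {q : ℂ} (hq : ‖q‖ < 1) :
    qFacInf x q = (1 - x) * qFacInf (x * q) q := by
  refine tendsto_nhds_unique ((tendsto_qFac x hq).comp (tendsto_add_atTop_nat 1)) ?_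
  refine ((tendsto_qFac (x * q) hq).const_mul (1 - x)).congr fun n => ?_
  exact (qFac_succ' x q n).symm

/-! ### The three-term contiguous relation of `₂φ₁` -/

/-- The general term of `₂φ₁`. -/
noncomputable def phiTerm (A B C q x : ℂ) (n : ℕ) : ℂ :=
  qFac A q n * qFac B q n / (qFac q q n * qFac C q n) * x ^ n

theorem phiTerm_zero (A B C q x : ℂ) : phiTerm A B C q x 0 = 1 := by simp [phiTerm, qFac_zero]

theorem phiTerm_eq (A B C q x : ℂ) (n : ℕ) : phiTerm A B C q x n =
    qFac A q n * (qFac B q n * x ^ n) / (qFac q q n * qFac C q n) := by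
  rw [phiTerm]; ring

theorem hasSum_phiTerm (A B C : ℂ) {q x : ℂ} (hq : ‖q‖ < 1) (hx : ‖x‖ < 1) :
    HasSum (phiTerm A B C q x) (phi21 A B C q x) :=
  (summable_phi21 A B C hq hx).hasSum

/-- The contiguous relation in telescoped form: the partial sums of its defect have a closed form, a
multiple of a single term of a convergent series, so the defect vanishes in the limit. -/
theorem sum_phiTerm_contiguous {A B C q x β : ℂ} (hq : ‖q‖ < 1) (hB : B * x = β * q)
    (hC : ∀ k : ℕ, 1 - C * q ^ k ≠ 0) (N : ℕ) :
    ∑ n ∈ Finset.range (N + 1), ((1 - C) * phiTerm A B C q x n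
        - (1 + β - C - x * A) * phiTerm (A * q) B (C * q) q x n
        + (1 - A * q) * (β - x * C) / (1 - C * q) *
          phiTerm (A * q ^ 2) B (C * q ^ 2) q x n) =
      (A - C) * phiTerm (A * q) B (C * q) q x N * (x - β * q ^ (N + 1)) /
        (1 - C * q ^ (N + 1)) := by
  have hC0 : 1 - C ≠ 0 := by simpa using hC 0
  have hC1 : 1 - C * q ≠ 0 := by simpa using hC 1
  have hCq : ∀ k : ℕ, 1 - C * q * q ^ k ≠ 0 := fun k => by
    simpa [pow_succ', mul_assoc] using hC (k + 1)
  induction N with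
  | zero =>
    simp only [zero_add, Finset.sum_range_one, phiTerm_zero, pow_one]
    field_simp
    ring
  | succ N ih =>
    rw [Finset.sum_range_succ, ih]
    have hk : 1 - q * q ^ N ≠ 0 := one_sub_mul_pow_ne_zero hq hq N
    have hqN : qFac q q N ≠ 0 := qFac_ne_zero (one_sub_mul_pow_ne_zero hq hq) N
    have hCN : qFac (C * q) q N ≠ 0 := qFac_ne_zero hCq N
    have e1 : 1 - C * q * q ^ N ≠ 0 := hCq N
    have e2 : 1 - C * q * q * q ^ N ≠ 0 := by
      have := hCq (N + 1)
      rwa [pow_succ', ← mul_assoc] at this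
    -- The parameter `B` occurs only through `(1 - B q^N) x = x - β q q^N`; this is where `B x = β
    -- q` enters.
    have hE : qFac B q (N + 1) * x ^ (N + 1) = qFac B q N * x ^ N * (x - β * q * q ^ N) := by
      rw [qFac_succ, pow_succ]
      linear_combination (-qFac B q N * x ^ N * q ^ N) * hB
    -- Each of the three summands of index `N + 1` is a rational multiple of `h`, since `(A;q)_{N+1}
    -- = (1 - A)(Aq;q)_N` and `(1 - Aq)(Aq²;q)_{N+1} = (Aq;q)_{N+2}`. The induction step thus
    -- becomes an identity of rational functions.
    set h := phiTerm (A * q) B (C * q) q x N with hh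
    have t1 : phiTerm A B C q x (N + 1) =
        h * ((1 - A) * (x - β * q * q ^ N)) / ((1 - q * q ^ N) * (1 - C)) := by
      rw [hh, phiTerm_eq, phiTerm_eq, hE, qFac_succ' A, qFac_succ' C, qFac_succ q]
      generalize q ^ N = Q at *
      field_simp
    have t2 : phiTerm (A * q) B (C * q) q x (N + 1) =
        h * ((1 - A * q * q ^ N) * (x - β * q * q ^ N)) /
          ((1 - q * q ^ N) * (1 - C * q * q ^ N)) := by
      rw [hh, phiTerm_eq, phiTerm_eq, hE, qFac_succ (A * q), qFac_succ (C * q), qFac_succ q]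
      generalize q ^ N = Q at *
      field_simp
    have a3 : (1 - A * q) * qFac (A * q ^ 2) q (N + 1) =
        qFac (A * q) q N * (1 - A * q * q ^ N) * (1 - A * q * q * q ^ N) := by
      rw [show A * q ^ 2 = A * q * q by ring, ← qFac_succ', qFac_succ, qFac_succ]
      ring
    have c3 : (1 - C * q) * qFac (C * q ^ 2) q (N + 1) =
        qFac (C * q) q N * (1 - C * q * q ^ N) * (1 - C * q * q * q ^ N) := by
      rw [show C * q ^ 2 = C * q * q by ring, ← qFac_succ', qFac_succ, qFac_succ]
      ring
    have t3 : (1 - A * q) * (β - x * C) / (1 - C * q) *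
          phiTerm (A * q ^ 2) B (C * q ^ 2) q x (N + 1) =
        (β - x * C) * (h * ((1 - A * q * q ^ N) * (1 - A * q * q * q ^ N) * (x - β * q * q ^ N)) /
          ((1 - q * q ^ N) * ((1 - C * q * q ^ N) * (1 - C * q * q * q ^ N)))) := by
      have : (1 - A * q) * (β - x * C) / (1 - C * q) *
          phiTerm (A * q ^ 2) B (C * q ^ 2) q x (N + 1) =
          (β - x * C) * (((1 - A * q) * qFac (A * q ^ 2) q (N + 1)) * (qFac B q (N + 1) * x ^ (N + 1)) /
            (qFac q q (N + 1) * ((1 - C * q) * qFac (C * q ^ 2) q (N + 1)))) := by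
        rw [phiTerm]; simp only [div_eq_mul_inv, mul_inv]; ring
      rw [this, a3, c3, hE, hh, phiTerm_eq, qFac_succ q]
      generalize q ^ N = Q at *
      congr 1
      field_simp
    rw [t1, t2, t3]
    have p1 : q ^ (N + 1) = q * q ^ N := pow_succ' q N
    have p2 : q ^ (N + 1 + 1) = q * (q * q ^ N) := by rw [pow_succ', p1]
    rw [p1, p2]
    generalize q ^ N = Q at *
    have e2' : 1 - C * q ^ 2 * Q ≠ 0 := by rwa [pow_two, ← mul_assoc]
    rw [show C * q * q * Q = C * q ^ 2 * Q by ring, show C * (q * (q * Q)) = C * q ^ 2 * Q by ring,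
      show C * (q * Q) = C * q * Q by ring]
    field_simp
    ring

theorem phi21_contiguous {A B C q x β : ℂ} (hq : ‖q‖ < 1) (hx : ‖x‖ < 1) (hB : B * x = β * q)
    (hC : ∀ k : ℕ, 1 - C * q ^ k ≠ 0) :
    (1 - C) * phi21 A B C q x = (1 + β - C - x * A) * phi21 (A * q) B (C * q) q x
        - (1 - A * q) * (β - x * C) / (1 - C * q) *
          phi21 (A * q ^ 2) B (C * q ^ 2) q x := by
  have h1 := (hasSum_phiTerm A B C hq hx).mul_left (1 - C)
  have h2 := (hasSum_phiTerm (A * q) B (C * q) hq hx).mul_left (1 + β - C - x * A)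
  have h3 := (hasSum_phiTerm (A * q ^ 2) B (C * q ^ 2) hq hx).mul_left
    ((1 - A * q) * (β - x * C) / (1 - C * q))
  have hs := (((h1.sub h2).add h3).tendsto_sum_nat).comp (tendsto_add_atTop_nat 1)
  have hpow : Tendsto (fun n : ℕ => q ^ (n + 1)) atTop (𝓝 0) :=
    (tendsto_pow_atTop_nhds_zero_of_norm_lt_one hq).comp (tendsto_add_atTop_nat 1)
  have hlim : Tendsto (fun N : ℕ => (A - C) * phiTerm (A * q) B (C * q) q x N *
      (x - β * q ^ (N + 1)) / (1 - C * q ^ (N + 1))) atTop (𝓝 0) := by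
    have h0 := (hasSum_phiTerm (A * q) B (C * q) hq hx).summable.tendsto_atTop_zero
    have := ((h0.const_mul (A - C)).mul ((hpow.const_mul β).const_sub x)).div
      ((hpow.const_mul C).const_sub 1) (by norm_num)
    simpa [Pi.div_def] using this
  have := tendsto_nhds_unique (hs.congr fun N => sum_phiTerm_contiguous hq hB hC N) hlim
  linear_combination this

/-! ### The `q`-binomial theorem and the limit of `₂φ₁` -/

/-- The series `∑ (B;q)_n / (q;q)_n xⁿ = ₁φ₀(B; q, x)`. -/
noncomputable def phi10 (B q x : ℂ) : ℂ := phi21 0 B 0 q x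

theorem phiTerm_zero_zero (B q x : ℂ) (n : ℕ) :
    phiTerm 0 B 0 q x n = qFac B q n / qFac q q n * x ^ n := by
  simp [phiTerm, qFac]

theorem phi10_step {B q x : ℂ} (hq : ‖q‖ < 1) (hx : ‖x‖ < 1) :
    (1 - x) * phi10 B q x = (1 - B * x) * phi10 B q (x * q) := by
  have hxq : ‖x * q‖ < 1 := by
    rw [norm_mul]; nlinarith [norm_nonneg x, norm_nonneg q]
  have h1 := hasSum_phiTerm 0 B 0 hq hx
  have h2 := hasSum_phiTerm 0 B 0 hq hxq
  have hs := (((h1.mul_left (1 - x)).sub (h2.mul_left (1 - B * x))).tendsto_sum_nat).comp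
    (tendsto_add_atTop_nat 1)
  have hpart : ∀ N : ℕ, ∑ n ∈ Finset.range (N + 1), ((1 - x) * phiTerm 0 B 0 q x n -
      (1 - B * x) * phiTerm 0 B 0 q (x * q) n) =
      -(x * phiTerm 0 B 0 q x N) + B * x * phiTerm 0 B 0 q (x * q) N := by
    intro N
    induction N with
    | zero => simp [phiTerm_zero]; ring
    | succ N ih =>
      rw [Finset.sum_range_succ, ih]
      have hk : 1 - q * q ^ N ≠ 0 := one_sub_mul_pow_ne_zero hq hq N
      have hqN : qFac q q N ≠ 0 := qFac_ne_zero (one_sub_mul_pow_ne_zero hq hq) N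
      simp only [phiTerm_zero_zero, qFac_succ, mul_pow, pow_succ]
      generalize q ^ N = Q at *
      rw [mul_comm q Q] at hk ⊢
      field_simp
      ring
  have hlim : Tendsto (fun N : ℕ => -(x * phiTerm 0 B 0 q x N) +
      B * x * phiTerm 0 B 0 q (x * q) N) atTop (𝓝 0) := by
    simpa using ((h1.summable.tendsto_atTop_zero.const_mul x).neg).add
      (h2.summable.tendsto_atTop_zero.const_mul (B * x))
  have := tendsto_nhds_unique (hs.congr hpart) hlim
  simp only [phi10]
  linear_combination this

/-- Iterating `phi10_step` moves the argument to `x q^N → 0`, where only the constant term of the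
series survives. -/
theorem qBinomial {B q x : ℂ} (hq : ‖q‖ < 1) (hx : ‖x‖ < 1) :
    qFacInf x q * phi10 B q x = qFacInf (B * x) q := by
  have hxq : ∀ N : ℕ, ‖x * q ^ N‖ < 1 := fun N => by
    rw [norm_mul, norm_pow]
    have := pow_le_one₀ (n := N) (norm_nonneg q) hq.le
    nlinarith [norm_nonneg x, norm_nonneg (q ^ N)]
  have hit : ∀ N : ℕ, qFac x q N * phi10 B q x = qFac (B * x) q N * phi10 B q (x * q ^ N) := by
    intro N
    induction N with
    | zero => simp [qFac_zero]
    | succ N ih =>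
      have := phi10_step (B := B) hq (hxq N)
      rw [qFac_succ, qFac_succ, pow_succ, ← mul_assoc x]
      linear_combination (1 - x * q ^ N) * ih + qFac (B * x) q N * this
  have hlim : Tendsto (fun N : ℕ => phi10 B q (x * q ^ N)) atTop (𝓝 (∑' n : ℕ, if n = 0 then 1 else 0)) := by
    refine tendsto_tsum_of_dominated_convergence
      (bound := fun n => ‖phiTerm 0 B 0 q x n‖) (hasSum_phiTerm 0 B 0 hq hx).summable.norm ?_ ?_
    · intro n
      have hpow : Tendsto (fun N : ℕ => q ^ N) atTop (𝓝 0) :=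
        tendsto_pow_atTop_nhds_zero_of_norm_lt_one hq
      change Tendsto (fun N : ℕ => phiTerm 0 B 0 q (x * q ^ N) n) _ _
      simp only [phiTerm_zero_zero]
      rcases eq_or_ne n 0 with rfl | hn
      · simp [qFac_zero]
      · have := (((hpow.const_mul x).pow n).const_mul (qFac B q n / qFac q q n))
        simpa [hn] using this
    · refine Eventually.of_forall fun N n => ?_
      change ‖phiTerm 0 B 0 q (x * q ^ N) n‖ ≤ _
      simp only [phiTerm_zero_zero, norm_mul, norm_pow]
      refine mul_le_mul_of_nonneg_left ?_ (norm_nonneg _)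
      exact pow_le_pow_left₀ (by positivity)
        (mul_le_of_le_one_right (norm_nonneg _) (pow_le_one₀ (norm_nonneg _) hq.le)) n
  rw [tsum_ite_eq] at hlim
  have h1 := (tendsto_qFac x hq).mul_const (phi10 B q x)
  have h2 := (tendsto_qFac (B * x) hq).mul hlim
  rw [mul_one] at h2
  exact tendsto_nhds_unique (h1.congr hit) h2

/-- The case `B = 0` of the `q`-binomial theorem exhibits an inverse of the product. -/
theorem qFacInf_ne_zero {x q : ℂ} (hq : ‖q‖ < 1) (hx : ‖x‖ < 1) : qFacInf x q ≠ 0 := by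
  intro h
  have := qBinomial (B := 0) hq hx
  rw [h] at this
  simp [qFacInf] at this

/-- Dominated convergence: the numerator factors are bounded uniformly, and the denominator factors
have modulus at least `1/2` once `C q^N` is small. The remaining factor is the term of the limit
series itself. -/
theorem tendsto_phi21 (u B C : ℂ) {q x : ℂ} (hq : ‖q‖ < 1) (hx : ‖x‖ < 1) :
    Tendsto (fun N : ℕ => phi21 (u * q ^ N) B (C * q ^ N) q x) atTop (𝓝 (phi10 B q x)) := by
  have hpow : Tendsto (fun N : ℕ => q ^ N) atTop (𝓝 0) :=
    tendsto_pow_atTop_nhds_zero_of_norm_lt_one hq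
  have hf : ∀ (y : ℂ) (n : ℕ), Tendsto (fun N : ℕ => qFac (y * q ^ N) q n) atTop (𝓝 1) := by
    intro y n
    have : Tendsto (fun N : ℕ => qFac (y * q ^ N) q n) atTop
        (𝓝 (∏ k ∈ Finset.range n, (1 - y * 0 * q ^ k))) :=
      tendsto_finsetProd _ fun k _ => ((hpow.const_mul y).mul_const (q ^ k)).const_sub 1
    simpa using this
  refine tendsto_tsum_of_dominated_convergence
    (f := fun N : ℕ => phiTerm (u * q ^ N) B (C * q ^ N) q x) (g := phiTerm 0 B 0 q x)
    (bound := fun n => Real.exp (‖u‖ * (1 - ‖q‖)⁻¹) * 2 * ‖phiTerm 0 B 0 q x n‖)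
    ((hasSum_phiTerm 0 B 0 hq hx).summable.norm.mul_left _) ?_ ?_
  · intro n
    have hqn : qFac q q n ≠ 0 := qFac_ne_zero (one_sub_mul_pow_ne_zero hq hq) n
    have := (((hf u n).mul_const (qFac B q n)).div ((hf C n).const_mul (qFac q q n))
      (by simpa using hqn)).mul_const (x ^ n)
    rw [phiTerm_zero_zero]
    simpa [Pi.div_def, phiTerm] using this
  · have h1 : ∀ᶠ N : ℕ in atTop, ‖C * q ^ N‖ * (1 - ‖q‖)⁻¹ < 1 / 2 := by
      have := ((hpow.const_mul C).norm.mul_const (1 - ‖q‖)⁻¹)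
      exact this.eventually (gt_mem_nhds (by simp))
    filter_upwards [h1] with N hN n
    have hu : ‖qFac (u * q ^ N) q n‖ ≤ Real.exp (‖u‖ * (1 - ‖q‖)⁻¹) := by
      refine (norm_qFac_le _ hq n).trans (Real.exp_le_exp.2 ?_)
      refine mul_le_mul_of_nonneg_right ?_ (inv_nonneg.2 (by linarith))
      rw [norm_mul, norm_pow]
      exact mul_le_of_le_one_right (norm_nonneg _) (pow_le_one₀ (norm_nonneg _) hq.le)
    have hc := half_le_norm_qFac hq hN.le n
    have hc' : ‖qFac (C * q ^ N) q n‖⁻¹ ≤ 2 := by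
      rw [inv_le_comm₀ (by linarith) (by norm_num)]
      linarith
    have e : phiTerm (u * q ^ N) B (C * q ^ N) q x n =
        qFac (u * q ^ N) q n * (qFac (C * q ^ N) q n)⁻¹ * phiTerm 0 B 0 q x n := by
      rw [phiTerm_zero_zero, phiTerm]
      simp only [div_eq_mul_inv, mul_inv]
      ring
    rw [e, norm_mul, norm_mul, norm_inv]
    exact mul_le_mul_of_nonneg_right (mul_le_mul hu hc' (by positivity) (by positivity))
      (norm_nonneg _)

/-- The limit of a solution of the three-term recurrence, through its Casoratian with the solution
given by `₂φ₁` of the adjoint recurrence. -/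
theorem limit_of_recurrence {V : ℕ → ℂ} {F u B C q x β ρ : ℂ} (hq : ‖q‖ < 1) (hx : ‖x‖ < 1)
    (hB : B * x = β * q) (hρ : ρ * q = x * C) (hC : ∀ k : ℕ, 1 - C * q ^ k ≠ 0)
    (hV : ∀ N : ℕ, V (N + 2) = (1 + β - (C + x * u) * q ^ N) * V (N + 1) -
      (1 - u * q ^ N) * (β - ρ * q ^ N) * V N)
    (hF : Tendsto V atTop (𝓝 F)) :
    F * qFacInf β q = qFacInf x q * qFacInf C q *
      (phi21 u B C q x * V 1 -
        (1 - u) * (β - ρ) / (1 - C) * phi21 (u * q) B (C * q) q x * V 0) := by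
  set φ : ℕ → ℂ := fun N => phi21 (u * q ^ N) B (C * q ^ N) q x with hφ
  -- The Casoratian of `V` and `φ`, normalised so that the contiguous relation makes `G (N + 1)` a
  -- scalar multiple of `G N`.
  set G : ℕ → ℂ := fun N => φ N * V (N + 1) -
    (1 - u * q ^ N) * (β - ρ * q ^ N) / (1 - C * q ^ N) * φ (N + 1) * V N with hG
  have hstep : ∀ N, G (N + 1) = (1 - C * q ^ N) * G N := by
    intro N
    have hCN : ∀ k : ℕ, 1 - C * q ^ N * q ^ k ≠ 0 := fun k => by
      simpa [pow_add, mul_assoc] using hC (N + k)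
    have h := phi21_contiguous (A := u * q ^ N) hq hx hB hCN
    have e1 : φ (N + 1) = phi21 (u * q ^ N * q) B (C * q ^ N * q) q x := by
      simp only [hφ, pow_succ, mul_assoc]
    have e2 : φ (N + 2) = phi21 (u * q ^ N * q ^ 2) B (C * q ^ N * q ^ 2) q x := by
      simp only [hφ, pow_add, mul_assoc]
    have e0 : φ N = phi21 (u * q ^ N) B (C * q ^ N) q x := rfl
    rw [← e0, ← e1, ← e2] at h
    simp only [hG]
    rw [hV N]
    have hcancel : (1 - C * q ^ N) * ((1 - u * q ^ N) * (β - ρ * q ^ N) / (1 - C * q ^ N)) =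
        (1 - u * q ^ N) * (β - ρ * q ^ N) := mul_div_cancel₀ _ (hC N)
    -- The relation `ρ q = x C` identifies the coefficient of the recurrence at `N + 1` with that of
    -- the contiguous relation at `N`.
    have hk : (1 - u * q ^ (N + 1)) * (β - ρ * q ^ (N + 1)) / (1 - C * q ^ (N + 1)) =
        (1 - u * q ^ N * q) * (β - x * (C * q ^ N)) / (1 - C * q ^ N * q) := by
      rw [pow_succ, show ρ * (q ^ N * q) = x * (C * q ^ N) by linear_combination q ^ N * hρ]
      simp only [mul_assoc]
    rw [hk]
    linear_combination (-V (N + 1)) * h + φ (N + 1) * V N * hcancel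
  have hprod : ∀ N, G N = qFac C q N * G 0 := by
    intro N
    induction N with
    | zero => simp [qFac_zero]
    | succ N ih => rw [hstep, ih, qFac_succ]; ring
  have hpow : Tendsto (fun N : ℕ => q ^ N) atTop (𝓝 0) :=
    tendsto_pow_atTop_nhds_zero_of_norm_lt_one hq
  have hφl : Tendsto φ atTop (𝓝 (phi10 B q x)) := tendsto_phi21 u B C hq hx
  have hl1 : Tendsto G atTop (𝓝 (phi10 B q x * F - β * phi10 B q x * F)) := by
    have h1 := hφl.mul (hF.comp (tendsto_add_atTop_nat 1))
    have h2 := ((((hpow.const_mul u).const_sub 1).mul ((hpow.const_mul ρ).const_sub β)).div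
      ((hpow.const_mul C).const_sub 1) (by norm_num)).mul
      (hφl.comp (tendsto_add_atTop_nat 1)) |>.mul hF
    have := h1.sub h2
    simpa using this
  have hl2 := (tendsto_qFac C hq).mul_const (G 0)
  have key := tendsto_nhds_unique (hl1.congr hprod) hl2
  have hb := qBinomial (B := B) hq hx
  have hG0 : G 0 = phi21 u B C q x * V 1 -
      (1 - u) * (β - ρ) / (1 - C) * phi21 (u * q) B (C * q) q x * V 0 := by
    simp [hG, hφ]
  -- The limit of `G` contributes `1 - β`, which completes `(βq;q)_∞ = (Bx;q)_∞` to `(β;q)_∞`.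
  rw [← hG0, qFacInf_eq_mul β hq, ← hB, ← hb]
  linear_combination qFacInf x q * key

/-! ### Removing the largest part of a partition -/

theorem IntPartition.ext_parts {p r : IntPartition} (h : p.2.parts = r.2.parts) : p = r := by
  obtain ⟨n, p⟩ := p
  obtain ⟨m, r⟩ := r
  have hnm : n = m := by
    rw [← p.parts_sum, ← r.parts_sum]
    exact congrArg Multiset.sum h
  subst hnm
  rw [show p = r from Nat.Partition.ext h]

/-- The partition with the given multiset of parts. -/
def ofParts (s : Multiset ℕ) (h : ∀ i ∈ s, 0 < i) : IntPartition :=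
  ⟨s.sum, ⟨s, fun {i} hi => h i hi, rfl⟩⟩

/-- The partition obtained by adding the part `m + 1`. -/
def consPart (m : ℕ) (p : IntPartition) : IntPartition :=
  ofParts ((m + 1) ::ₘ p.2.parts) fun i hi => by
    rcases Multiset.mem_cons.1 hi with rfl | hi
    · exact Nat.succ_pos m
    · exact p.2.parts_pos hi

theorem consPart_parts (m : ℕ) (p : IntPartition) :
    (consPart m p).2.parts = (m + 1) ::ₘ p.2.parts := rfl

theorem consPart_injective (m : ℕ) : Function.Injective (consPart m) := fun p r h =>
  IntPartition.ext_parts <| (Multiset.cons_inj_right (m + 1)).1 <| by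
    rw [← consPart_parts, h, consPart_parts]

theorem exists_eq_consPart {m : ℕ} {p : IntPartition} (h : m + 1 ∈ p.2.parts) :
    ∃ r, p = consPart m r := by
  refine ⟨ofParts (p.2.parts.erase (m + 1)) fun i hi =>
    p.2.parts_pos (Multiset.mem_of_mem_erase hi), IntPartition.ext_parts ?_⟩
  exact (Multiset.cons_erase h).symm

theorem length_consPart (m : ℕ) (p : IntPartition) :
    length (consPart m p) = length p + 1 := by
  simp [length, consPart_parts]

/-! ### The weight of a partition in terms of its largest part -/

/-- The sum of `g` over the entries of `l` at the places `0, 2, 4, …`. -/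
def evenPlaceSum (g : ℕ → ℕ) (l : List ℕ) : ℕ :=
  ∑ i ∈ Finset.range l.length, g (l.getD (2 * i) 0)

/-- The sum of `g` over the entries of `l` at the places `1, 3, 5, …`. -/
def oddPlaceSum (g : ℕ → ℕ) (l : List ℕ) : ℕ :=
  ∑ i ∈ Finset.range l.length, g (l.getD (2 * i + 1) 0)

theorem evenPlaceSum_cons (g : ℕ → ℕ) (m : ℕ) (l : List ℕ) :
    evenPlaceSum g (m :: l) = g m + oddPlaceSum g l := by
  rw [evenPlaceSum, List.length_cons, Finset.sum_range_succ', add_comm]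
  rfl

theorem oddPlaceSum_cons {g : ℕ → ℕ} (hg : g 0 = 0) (m : ℕ) (l : List ℕ) :
    oddPlaceSum g (m :: l) = evenPlaceSum g l := by
  rw [oddPlaceSum, List.length_cons, Finset.sum_range_succ]
  -- The longer list has one extra summation index; its place lies beyond the end, where the default
  -- `0` is killed by `g 0 = 0`.
  have : (m :: l).getD (2 * l.length + 1) 0 = 0 :=
    List.getD_eq_default _ _ (by rw [List.length_cons]; omega)
  rw [this, hg, add_zero]
  rfl

theorem sum_Icc_one (f : ℕ → ℕ) (n : ℕ) :
    ∑ i ∈ Finset.Icc 1 n, f i = ∑ i ∈ Finset.range n, f (i + 1) := by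
  induction n with
  | zero => simp
  | succ n ih => rw [Finset.sum_Icc_succ_top (by omega), ih, Finset.sum_range_succ]

/-- The parts in decreasing order. -/
def sortedParts (p : IntPartition) : List ℕ := p.2.parts.sort (· ≥ ·)

theorem weight_eq (a b c d : ℂ) (p : IntPartition) :
    weight a b c d p =
      a ^ evenPlaceSum (fun m => (m + 1) / 2) (sortedParts p) *
      b ^ evenPlaceSum (fun m => m / 2) (sortedParts p) *
      c ^ oddPlaceSum (fun m => (m + 1) / 2) (sortedParts p) *
      d ^ oddPlaceSum (fun m => m / 2) (sortedParts p) := by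
  have hl : length p = (sortedParts p).length := by simp [length, sortedParts]
  have h1 : ∀ i, part p (2 * (i + 1) - 1) = (sortedParts p).getD (2 * i) 0 := fun i => by
    rw [part, show 2 * (i + 1) - 1 - 1 = 2 * i by omega, sortedParts]
  have h2 : ∀ i, part p (2 * (i + 1)) = (sortedParts p).getD (2 * i + 1) 0 := fun i => by
    rw [part, show 2 * (i + 1) - 1 = 2 * i + 1 by omega, sortedParts]
  simp only [weight, sum_Icc_one, h1, h2, hl, evenPlaceSum, oddPlaceSum]

/-- The weight of a largest part `m`. -/
noncomputable def partWeight (a b : ℂ) (m : ℕ) : ℂ := a ^ ((m + 1) / 2) * b ^ (m / 2)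

/-- A new largest part pushes all others one place down, so odd and even places, and with them `(a,
b)` and `(c, d)`, are exchanged. -/
theorem weight_consPart (a b c d : ℂ) {m : ℕ} {p : IntPartition}
    (h : ∀ i ∈ p.2.parts, i ≤ m + 1) :
    weight a b c d (consPart m p) = partWeight a b (m + 1) * weight c d a b p := by
  have hs : sortedParts (consPart m p) = (m + 1) :: sortedParts p := Multiset.sort_cons _ _ _ h
  rw [weight_eq, weight_eq, hs, evenPlaceSum_cons, evenPlaceSum_cons,
    oddPlaceSum_cons (by norm_num), oddPlaceSum_cons (by norm_num), partWeight, pow_add, pow_add]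
  ring

/-- The summand `ω(λ) z^{ℓ(λ)}`. -/
noncomputable def term (a b c d z : ℂ) (p : IntPartition) : ℂ := weight a b c d p * z ^ length p

theorem term_consPart (a b c d z : ℂ) {m : ℕ} {p : IntPartition}
    (h : ∀ i ∈ p.2.parts, i ≤ m + 1) :
    term a b c d z (consPart m p) = z * partWeight a b (m + 1) * term c d a b z p := by
  rw [term, weight_consPart a b c d h, length_consPart, term, pow_succ]
  ring

/-- The empty partition. -/
def emptyPart : IntPartition := ofParts 0 (by simp)

theorem term_emptyPart (a b c d z : ℂ) : term a b c d z emptyPart = 1 := by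
  simp [term, weight, length, emptyPart, ofParts]

theorem eq_emptyPart {p : IntPartition} (h : ∀ m ∈ p.2.parts, m ≤ 0) : p = emptyPart := by
  refine IntPartition.ext_parts (Multiset.eq_zero_of_forall_notMem fun m hm => ?_)
  have := p.2.parts_pos hm
  have := h m hm
  omega

/-! ### Strict partitions with bounded parts -/

theorem strictLE_zero : strictLE 0 = {emptyPart} := by
  refine Set.Subset.antisymm (fun p hp => eq_emptyPart hp.2) ?_
  rintro _ rfl
  exact ⟨Multiset.nodup_zero, by simp [emptyPart, ofParts]⟩

theorem mem_strictLE_succ {N : ℕ} {p : IntPartition} :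
    p ∈ strictLE (N + 1) ↔ p ∈ strictLE N ∨ ∃ r ∈ strictLE N, consPart N r = p := by
  constructor
  · intro hp
    by_cases h : N + 1 ∈ p.2.parts
    · obtain ⟨r, rfl⟩ := exists_eq_consPart h
      obtain ⟨h1, h2⟩ := hp
      rw [IsStrict, consPart_parts, Multiset.nodup_cons] at h1
      refine Or.inr ⟨r, ⟨h1.2, fun m hm => ?_⟩, rfl⟩
      have h3 := h2 m (by rw [consPart_parts]; exact Multiset.mem_cons_of_mem hm)
      have h4 : m ≠ N + 1 := fun e => h1.1 (e ▸ hm)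
      omega
    · refine Or.inl ⟨hp.1, fun m hm => ?_⟩
      have h3 := hp.2 m hm
      have h4 : m ≠ N + 1 := fun e => h (e ▸ hm)
      omega
  · rintro (hp | ⟨r, hr, rfl⟩)
    · exact ⟨hp.1, fun m hm => (hp.2 m hm).trans N.le_succ⟩
    · refine ⟨?_, fun m hm => ?_⟩
      · rw [IsStrict, consPart_parts, Multiset.nodup_cons]
        exact ⟨fun h => absurd (hr.2 _ h) (by omega), hr.1⟩
      · rw [consPart_parts] at hm
        rcases Multiset.mem_cons.1 hm with rfl | hm
        · exact le_rfl
        · exact (hr.2 m hm).trans N.le_succ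

theorem sum_strictLE_zero {M : Type*} [AddCommMonoid M] (F : IntPartition → M) :
    ∑ p ∈ (strictLE_finite 0).toFinset, F p = F emptyPart := by
  rw [show (strictLE_finite 0).toFinset = {emptyPart} by
    ext p; simp [strictLE_zero], Finset.sum_singleton]

open Classical in
theorem sum_strictLE_succ {M : Type*} [AddCommMonoid M] (F : IntPartition → M) (N : ℕ) :
    ∑ p ∈ (strictLE_finite (N + 1)).toFinset, F p =
      ∑ p ∈ (strictLE_finite N).toFinset, F p +
        ∑ p ∈ (strictLE_finite N).toFinset, F (consPart N p) := by
  have hU : (strictLE_finite (N + 1)).toFinset = (strictLE_finite N).toFinset ∪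
      ((strictLE_finite N).toFinset.image (consPart N)) := by
    ext p
    simp [mem_strictLE_succ]
  rw [hU, Finset.sum_union, Finset.sum_image fun _ _ _ _ h => consPart_injective N h]
  rw [Finset.disjoint_left]
  intro p hp hp'
  obtain ⟨r, -, rfl⟩ := Finset.mem_image.1 hp'
  have := ((Set.Finite.mem_toFinset _).1 hp).2 (N + 1) (by simp [consPart_parts])
  omega

theorem Psi_zero (a b c d z : ℂ) : Psi 0 a b c d z = 1 := by
  rw [Psi, sum_strictLE_zero]
  exact term_emptyPart a b c d z

theorem Psi_succ (N : ℕ) (a b c d z : ℂ) :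
    Psi (N + 1) a b c d z =
      Psi N a b c d z + z * partWeight a b (N + 1) * Psi N c d a b z := by
  rw [Psi, sum_strictLE_succ, Psi, Psi, Finset.mul_sum]
  congr 1
  refine Finset.sum_congr rfl fun p hp => ?_
  exact term_consPart a b c d z fun i hi =>
    (((Set.Finite.mem_toFinset _).1 hp).2 i hi).trans N.le_succ

/-! ### Summability over the strict partitions -/

theorem norm_partWeight_le {a b : ℂ} {r : ℝ} (ha : ‖a‖ ≤ r) (hb : ‖b‖ ≤ r) (m : ℕ) :
    ‖partWeight a b m‖ ≤ r ^ m := by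
  have hr : 0 ≤ r := (norm_nonneg a).trans ha
  calc ‖partWeight a b m‖ = ‖a‖ ^ ((m + 1) / 2) * ‖b‖ ^ (m / 2) := by
        rw [partWeight, norm_mul, norm_pow, norm_pow]
    _ ≤ r ^ ((m + 1) / 2) * r ^ (m / 2) :=
        mul_le_mul (pow_le_pow_left₀ (norm_nonneg _) ha _)
          (pow_le_pow_left₀ (norm_nonneg _) hb _) (by positivity) (by positivity)
    _ = r ^ m := by rw [← pow_add]; congr 1; omega

theorem prod_one_add_geometric_le {K r : ℝ} (hK : 0 ≤ K) (hr : 0 ≤ r) (hr1 : r < 1) (N : ℕ) :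
    ∏ k ∈ Finset.range N, (1 + K * r ^ k) ≤ Real.exp (K * (1 - r)⁻¹) := by
  refine (Real.prod_one_add_le_exp_sum _ fun k => by positivity).trans (Real.exp_le_exp.2 ?_)
  rw [← tsum_geometric_of_lt_one hr hr1, ← tsum_mul_left]
  exact ((summable_geometric_of_lt_one hr hr1).mul_left K).sum_le_tsum _
    fun k _ => by positivity

/-- The common bound `r` for the four moduli is invariant under the exchange of `(a, b)` and `(c,
d)`, so one induction handles both weights. -/
theorem sum_norm_strictLE_le (N : ℕ) {a b c d : ℂ} (z : ℂ) {r : ℝ} (hr1 : r < 1)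
    (ha : ‖a‖ ≤ r) (hb : ‖b‖ ≤ r) (hc : ‖c‖ ≤ r) (hd : ‖d‖ ≤ r) :
    ∑ p ∈ (strictLE_finite N).toFinset, ‖term a b c d z p‖ ≤
      ∏ k ∈ Finset.range N, (1 + ‖z‖ * r ^ k) := by
  have hr : 0 ≤ r := (norm_nonneg a).trans ha
  induction N generalizing a b c d with
  | zero => simp [sum_strictLE_zero, term_emptyPart]
  | succ N ih =>
    rw [sum_strictLE_succ, Finset.prod_range_succ, mul_add, mul_one]
    refine add_le_add (ih ha hb hc hd) ?_
    have : ∀ p ∈ (strictLE_finite N).toFinset, ‖term a b c d z (consPart N p)‖ ≤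
        ‖z‖ * r ^ N * ‖term c d a b z p‖ := fun p hp => by
      rw [term_consPart a b c d z fun i hi =>
        (((Set.Finite.mem_toFinset _).1 hp).2 i hi).trans N.le_succ, norm_mul, norm_mul]
      refine mul_le_mul_of_nonneg_right (mul_le_mul_of_nonneg_left ?_ (norm_nonneg _))
        (norm_nonneg _)
      exact (norm_partWeight_le ha hb _).trans (pow_le_pow_of_le_one hr hr1.le N.le_succ)
    refine (Finset.sum_le_sum this).trans ?_
    rw [← Finset.mul_sum, mul_comm]
    exact mul_le_mul_of_nonneg_right (ih hc hd ha hb) (by positivity)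

theorem le_size {p : IntPartition} {m : ℕ} (hm : m ∈ p.2.parts) : m ≤ p.1 := by
  rw [← p.2.parts_sum]
  exact Multiset.single_le_sum (fun _ _ => Nat.zero_le _) m hm

theorem summable_strict {a b c d : ℂ} (ha : ‖a‖ < 1) (hb : ‖b‖ < 1) (hc : ‖c‖ < 1)
    (hd : ‖d‖ < 1) (z : ℂ) :
    Summable fun μ : StrictPartition => term a b c d z μ.1 := by
  classical
  obtain ⟨r, hr, ha', hb', hc', hd'⟩ : ∃ r : ℝ, r < 1 ∧ ‖a‖ ≤ r ∧ ‖b‖ ≤ r ∧ ‖c‖ ≤ r ∧ ‖d‖ ≤ r :=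
    ⟨max (max ‖a‖ ‖b‖) (max ‖c‖ ‖d‖), by simp [ha, hb, hc, hd], by simp, by simp, by simp, by simp⟩
  refine Summable.of_norm (summable_of_sum_le (c := Real.exp (‖z‖ * (1 - r)⁻¹))
    (fun _ => norm_nonneg _) fun u => ?_)
  set N := u.sup fun μ => μ.1.1
  calc ∑ μ ∈ u, ‖term a b c d z μ.1‖ =
        ∑ p ∈ u.map (Function.Embedding.subtype _), ‖term a b c d z p‖ := by
          rw [Finset.sum_map]; rfl
    _ ≤ ∑ p ∈ (strictLE_finite N).toFinset, ‖term a b c d z p‖ := by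
          refine Finset.sum_le_sum_of_subset_of_nonneg (fun p hp => ?_) fun _ _ _ => norm_nonneg _
          obtain ⟨μ, hμ, rfl⟩ := Finset.mem_map.1 hp
          exact (Set.Finite.mem_toFinset _).2 ⟨μ.2, fun m hm => (le_size hm).trans
            (Finset.le_sup (f := fun μ : StrictPartition => μ.1.1) hμ)⟩
    _ ≤ _ := (sum_norm_strictLE_le N z hr ha' hb' hc' hd').trans
          (prod_one_add_geometric_le (norm_nonneg z) ((norm_nonneg a).trans ha') hr N)

/-- Partial sums over the strict partitions with bounded parts converge to the full sum. -/
theorem tendsto_sum_strictLE {F : IntPartition → ℂ}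
    (hF : Summable fun μ : StrictPartition => F μ.1) :
    Tendsto (fun N => ∑ p ∈ (strictLE_finite N).toFinset, F p) atTop
      (𝓝 (∑' μ : StrictPartition, F μ.1)) := by
  classical
  have hmap : ∀ N, ∑ p ∈ (strictLE_finite N).toFinset, F p =
      ∑ μ ∈ (strictLE_finite N).toFinset.subtype IsStrict, F μ.1 := fun N => by
    rw [Finset.sum_subtype_eq_sum_filter, Finset.filter_true_of_mem]
    exact fun p hp => ((Set.Finite.mem_toFinset _).1 hp).1
  simp only [hmap]
  refine hF.hasSum.comp (tendsto_atTop_finset_of_monotone (fun N M h μ hμ => ?_) fun μ => ?_)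
  · rw [Finset.mem_subtype, Set.Finite.mem_toFinset] at hμ ⊢
    exact ⟨hμ.1, fun m hm => (hμ.2 m hm).trans h⟩
  · refine ⟨μ.1.1, ?_⟩
    rw [Finset.mem_subtype, Set.Finite.mem_toFinset]
    exact ⟨μ.2, fun m hm => le_size hm⟩

theorem tendsto_Psi {a b c d : ℂ} (ha : ‖a‖ < 1) (hb : ‖b‖ < 1) (hc : ‖c‖ < 1)
    (hd : ‖d‖ < 1) (z : ℂ) :
    Tendsto (fun N => Psi N a b c d z) atTop
      (𝓝 (∑' μ : StrictPartition, weight a b c d μ.1 * z ^ length μ.1)) :=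
  tendsto_sum_strictLE (F := term a b c d z) (summable_strict ha hb hc hd z)

/-! ### The three-term recurrences -/

theorem partWeight_even (a b : ℂ) (k : ℕ) : partWeight a b (2 * k) = (a * b) ^ k := by
  rw [partWeight, show (2 * k + 1) / 2 = k by omega, show 2 * k / 2 = k by omega, mul_pow]

theorem partWeight_odd (a b : ℂ) (k : ℕ) : partWeight a b (2 * k + 1) = a * (a * b) ^ k := by
  rw [partWeight, show (2 * k + 1 + 1) / 2 = k + 1 by omega,
    show (2 * k + 1) / 2 = k by omega, mul_pow, pow_succ]
  ring

/-- `hstep` is a linear map on the pair formed by the function and its exchanged companion.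
Expressing `X (N + 2)` and `X (N + 1)` through the pair at `2 * N` makes the companion cancel. -/
theorem X_recurrence (N : ℕ) (a b c d z : ℂ) :
    X (N + 2) a b c d z =
      (1 + a * b + a * (1 + b * c) * z ^ 2 * (a * b * c * d) ^ (N + 1)) * X (N + 1) a b c d z -
      a * b * (1 - z ^ 2 * (a * b * c * d) ^ (N + 1)) *
        (1 - a * c * z ^ 2 * (a * b * c * d) ^ N) * X N a b c d z := by
  have hstep : ∀ (N : ℕ) (a b c d : ℂ), Psi (2 * (N + 1)) a b c d z =
      Psi (2 * N) a b c d z + z * (a * (a * b) ^ N) * Psi (2 * N) c d a b z +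
      z * (a * b) ^ (N + 1) *
        (Psi (2 * N) c d a b z + z * (c * (c * d) ^ N) * Psi (2 * N) a b c d z) := by
    intro N a b c d
    rw [show 2 * (N + 1) = 2 * N + 1 + 1 by ring, Psi_succ, Psi_succ, Psi_succ (2 * N) c d a b,
      partWeight_odd, partWeight_odd, show 2 * N + 1 + 1 = 2 * (N + 1) by ring, partWeight_even]
  have hq : (a * b * c * d) ^ N = (a * b) ^ N * (c * d) ^ N := by
    rw [← mul_pow]; congr 1; ring
  simp only [X]
  rw [show N + 2 = N + 1 + 1 by rfl, hstep (N + 1), hstep N a b, hstep N c d]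
  simp only [pow_succ, hq]
  ring

theorem Y_recurrence (N : ℕ) (a b c d z : ℂ) :
    Y (N + 2) a b c d z =
      (1 + a * b + a * b * c * (1 + a * d) * z ^ 2 * (a * b * c * d) ^ (N + 1)) *
        Y (N + 1) a b c d z -
      a * b * (1 - z ^ 2 * (a * b * c * d) ^ (N + 1)) *
        (1 - a * c * z ^ 2 * (a * b * c * d) ^ (N + 1)) * Y N a b c d z := by
  have hstep : ∀ (N : ℕ) (a b c d : ℂ), Psi (2 * (N + 1) + 1) a b c d z =
      Psi (2 * N + 1) a b c d z + z * (a * b) ^ (N + 1) * Psi (2 * N + 1) c d a b z +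
      z * (a * (a * b) ^ (N + 1)) *
        (Psi (2 * N + 1) c d a b z + z * (c * d) ^ (N + 1) * Psi (2 * N + 1) a b c d z) := by
    intro N a b c d
    rw [Psi_succ, partWeight_odd, show 2 * (N + 1) = 2 * N + 1 + 1 by ring, Psi_succ,
      Psi_succ (2 * N + 1) c d a b, show 2 * N + 1 + 1 = 2 * (N + 1) by ring, partWeight_even,
      partWeight_even]
  have hq : (a * b * c * d) ^ N = (a * b) ^ N * (c * d) ^ N := by
    rw [← mul_pow]; congr 1; ring
  simp only [Y]
  rw [show N + 2 = N + 1 + 1 by rfl, hstep (N + 1), hstep N a b, hstep N c d]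
  simp only [pow_succ, hq]
  ring

/-! ### All partitions with bounded parts -/

/-- The partitions with all parts at most `N`. -/
def partsLE (N : ℕ) : Set IntPartition := {p | ∀ m ∈ p.2.parts, m ≤ N}

theorem partsLE_zero : partsLE 0 = {emptyPart} := by
  refine Set.Subset.antisymm (fun p hp => eq_emptyPart hp) ?_
  rintro _ rfl
  simp [partsLE, emptyPart, ofParts]

/-- Parts may repeat, so deleting one copy of `N + 1` may leave others: unlike in the strict case,
`partsLE (N + 1)` occurs on both sides. -/
theorem partsLE_succ (N : ℕ) :
    partsLE (N + 1) = partsLE N ∪ consPart N '' partsLE (N + 1) := by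
  ext p
  constructor
  · intro hp
    by_cases h : N + 1 ∈ p.2.parts
    · obtain ⟨r, rfl⟩ := exists_eq_consPart h
      exact Or.inr ⟨r, fun m hm => hp m (by
        rw [consPart_parts]; exact Multiset.mem_cons_of_mem hm), rfl⟩
    · refine Or.inl fun m hm => ?_
      have h3 := hp m hm
      have h4 : m ≠ N + 1 := fun e => h (e ▸ hm)
      omega
  · rintro (hp | ⟨r, hr, rfl⟩)
    · exact fun m hm => (hp m hm).trans N.le_succ
    · intro m hm
      rw [consPart_parts] at hm
      rcases Multiset.mem_cons.1 hm with rfl | hm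
      · exact le_rfl
      · exact hr m hm

theorem disjoint_partsLE (N : ℕ) :
    Disjoint (partsLE N) (consPart N '' partsLE (N + 1)) := by
  rw [Set.disjoint_left]
  rintro _ hp ⟨r, -, rfl⟩
  have := hp (N + 1) (by simp [consPart_parts])
  omega

theorem tsum_partsLE_succ {F : IntPartition → ℂ} (hF : Summable F) (N : ℕ) :
    ∑' p : partsLE (N + 1), F p =
      ∑' p : partsLE N, F p + ∑' p : partsLE (N + 1), F (consPart N p) := by
  conv_lhs => rw [partsLE_succ]
  rw [Summable.tsum_union_disjoint (disjoint_partsLE N) (hF.subtype _) (hF.subtype _),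
    tsum_image F (consPart_injective N).injOn]

/-- The partitions with all parts at most `N` and at most `L` parts. -/
def boxed (N L : ℕ) : Set IntPartition := {p | p ∈ partsLE N ∧ length p ≤ L}

theorem boxed_finite (N L : ℕ) : (boxed N L).Finite := by
  refine Set.Finite.of_finite_image (f := fun p : IntPartition => p.2.parts) ?_
    (fun p _ r _ h => IntPartition.ext_parts h)
  refine Set.Finite.subset (Set.finite_Iic (L • Multiset.range (N + 1))) ?_
  rintro _ ⟨p, ⟨hp, hl⟩, rfl⟩
  refine Multiset.le_iff_count.2 fun m => ?_
  by_cases hm : m ∈ p.2.parts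
  · have h1 : Multiset.count m (Multiset.range (N + 1)) = 1 :=
      Multiset.count_eq_one_of_mem (Multiset.nodup_range _)
        (Multiset.mem_range.2 (Nat.lt_succ_of_le (hp m hm)))
    rw [Multiset.count_nsmul, h1, mul_one]
    exact (Multiset.count_le_card m _).trans hl
  · simp [Multiset.count_eq_zero_of_notMem hm]

open Classical in
theorem sum_boxed_succ_le {G : IntPartition → ℝ} (hG : ∀ p, 0 ≤ G p) (N L : ℕ) :
    ∑ p ∈ (boxed_finite (N + 1) L).toFinset, G p ≤
      ∑ p ∈ (boxed_finite N L).toFinset, G p +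
        ∑ p ∈ (boxed_finite (N + 1) L).toFinset, G (consPart N p) := by
  rw [← Finset.sum_image (f := G) fun _ _ _ _ h => consPart_injective N h]
  have hsub : (boxed_finite (N + 1) L).toFinset ⊆ (boxed_finite N L).toFinset ∪
      (boxed_finite (N + 1) L).toFinset.image (consPart N) := by
    intro p hp
    rw [Set.Finite.mem_toFinset] at hp
    have h := hp.1
    rw [partsLE_succ] at h
    rcases h with h | ⟨r, hr, rfl⟩
    · exact Finset.mem_union_left _ ((Set.Finite.mem_toFinset _).2 ⟨h, hp.2⟩)
    · refine Finset.mem_union_right _ (Finset.mem_image_of_mem _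
        ((Set.Finite.mem_toFinset _).2 ⟨hr, ?_⟩))
      have := hp.2
      rw [length_consPart] at this
      omega
  refine (Finset.sum_le_sum_of_subset_of_nonneg hsub fun p _ _ => hG p).trans ?_
  rw [← Finset.sum_union_inter]
  exact le_add_of_nonneg_right (Finset.sum_nonneg fun p _ => hG p)

/-! ### Summability over all partitions -/

/-- The product of the weights of two adjacent parts `m`, with `z²`. -/
noncomputable def pairWeight (a b c d z : ℂ) (m : ℕ) : ℂ :=
  z ^ 2 * (partWeight a b m * partWeight c d m)

theorem pairWeight_even (a b c d z : ℂ) (k : ℕ) :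
    pairWeight a b c d z (2 * k) = z ^ 2 * (a * b * c * d) ^ k := by
  rw [pairWeight, partWeight_even, partWeight_even, ← mul_pow]
  congr 2
  ring

theorem pairWeight_odd (a b c d z : ℂ) (k : ℕ) :
    pairWeight a b c d z (2 * k + 1) = a * c * z ^ 2 * (a * b * c * d) ^ k := by
  rw [pairWeight, partWeight_odd, partWeight_odd,
    show a * b * c * d = (a * b) * (c * d) by ring, mul_pow]
  ring

/-- The pair weights for positive parts are `acz² q^k` and `z² q^(k+1) = acz² · bd · q^k`. This is
why `|acz²| < 1` alone suffices in (5). -/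
theorem norm_pairWeight_le {a b c d z : ℂ} (ha : ‖a‖ < 1) (hb : ‖b‖ < 1) (hc : ‖c‖ < 1)
    (hd : ‖d‖ < 1) (m : ℕ) : ‖pairWeight a b c d z (m + 1)‖ ≤ ‖a * c * z ^ 2‖ := by
  have hbd : ‖b * d‖ ≤ 1 := by
    rw [norm_mul]; exact mul_le_one₀ hb.le (norm_nonneg _) hd.le
  have hac : ‖a * c‖ ≤ 1 := by
    rw [norm_mul]; exact mul_le_one₀ ha.le (norm_nonneg _) hc.le
  have hq : ‖a * b * c * d‖ ≤ 1 := by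
    rw [show a * b * c * d = (a * c) * (b * d) by ring, norm_mul]
    exact mul_le_one₀ hac (norm_nonneg _) hbd
  have hqk : ∀ k : ℕ, ‖(a * b * c * d) ^ k‖ ≤ 1 := fun k => by
    rw [norm_pow]; exact pow_le_one₀ (norm_nonneg _) hq
  rcases Nat.even_or_odd' m with ⟨k, rfl | rfl⟩
  · rw [pairWeight_odd, norm_mul]
    exact mul_le_of_le_one_right (norm_nonneg _) (hqk k)
  · rw [show 2 * k + 1 + 1 = 2 * (k + 1) by ring, pairWeight_even,
      show z ^ 2 * (a * b * c * d) ^ (k + 1) =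
        (a * c * z ^ 2) * ((b * d) * (a * b * c * d) ^ k) by ring, norm_mul, norm_mul (b * d)]
    exact mul_le_of_le_one_right (norm_nonneg _) (mul_le_one₀ hbd (norm_nonneg _) (hqk k))

/-- Deleting the largest part twice bounds the sum by an expression containing itself with factor `t
< 1`. The bound `L` on the length makes the sum finite, so that the inequality can be solved; the
result does not involve `L`. -/
theorem sum_norm_boxed_le (N L : ℕ) {a b c d z : ℂ} {r : ℝ} (hr1 : r < 1)
    (ha : ‖a‖ ≤ r) (hb : ‖b‖ ≤ r) (hc : ‖c‖ ≤ r) (hd : ‖d‖ ≤ r) (hz : ‖a * c * z ^ 2‖ < 1) :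
    ∑ p ∈ (boxed_finite N L).toFinset, ‖term a b c d z p‖ ≤
      ∏ k ∈ Finset.range N, ((1 + ‖z‖ * r ^ k) *
        (1 + ‖z‖ ^ 2 / (1 - ‖a * c * z ^ 2‖) * r ^ k)) := by
  have hr : 0 ≤ r := (norm_nonneg a).trans ha
  -- `T` is fixed before the induction because the exchange turns `a * c` into `c * a`, while the
  -- bound must stay the same.
  obtain ⟨T, hT⟩ : ∃ T, T = ‖a * c * z ^ 2‖ := ⟨_, rfl⟩
  rw [← hT] at hz ⊢
  induction N generalizing a b c d with
  | zero =>
    rw [Finset.prod_range_zero, show (boxed_finite 0 L).toFinset = {emptyPart} by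
      ext p
      rw [Set.Finite.mem_toFinset, Finset.mem_singleton, boxed, Set.mem_ofPred_eq, partsLE_zero,
        Set.mem_singleton_iff]
      exact ⟨fun h => h.1, fun h => ⟨h, by subst h; exact Nat.zero_le L⟩⟩]
    simp [term_emptyPart]
  | succ N ih =>
    have hT' : T = ‖c * a * z ^ 2‖ := by rw [mul_comm c a, hT]
    have hcons : ∀ {a b c d : ℂ}, ∑ p ∈ (boxed_finite (N + 1) L).toFinset,
        ‖term a b c d z (consPart N p)‖ = ‖z‖ * ‖partWeight a b (N + 1)‖ *
          ∑ p ∈ (boxed_finite (N + 1) L).toFinset, ‖term c d a b z p‖ := by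
      intro a b c d
      rw [Finset.mul_sum]
      refine Finset.sum_congr rfl fun p hp => ?_
      rw [term_consPart a b c d z ((Set.Finite.mem_toFinset _).1 hp).1, norm_mul, norm_mul]
    have h1 := sum_boxed_succ_le (fun p => norm_nonneg (term a b c d z p)) N L
    have h2 := sum_boxed_succ_le (fun p => norm_nonneg (term c d a b z p)) N L
    rw [hcons] at h1 h2
    have i1 := ih ha hb hc hd hT
    have i2 := ih hc hd ha hb hT'
    have hpair : ‖z‖ * ‖partWeight a b (N + 1)‖ * (‖z‖ * ‖partWeight c d (N + 1)‖) =
        ‖pairWeight a b c d z (N + 1)‖ := by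
      rw [pairWeight, norm_mul, norm_mul, norm_pow]; ring
    have hp1 : ‖pairWeight a b c d z (N + 1)‖ ≤ T := hT ▸
      norm_pairWeight_le (ha.trans_lt hr1) (hb.trans_lt hr1) (hc.trans_lt hr1) (hd.trans_lt hr1) N
    have hrN : r ^ (N + 1) ≤ r ^ N := pow_le_pow_of_le_one hr hr1.le N.le_succ
    have hw1 := (norm_partWeight_le ha hb (N + 1)).trans hrN
    have hw2 := (norm_partWeight_le hc hd (N + 1)).trans hrN
    have hrN1 : r ^ N ≤ 1 := pow_le_one₀ hr hr1.le
    have hp2 : ‖pairWeight a b c d z (N + 1)‖ ≤ ‖z‖ ^ 2 * r ^ N := by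
      rw [pairWeight, norm_mul, norm_mul, norm_pow]
      refine mul_le_mul_of_nonneg_left ?_ (by positivity)
      exact (mul_le_of_le_one_right (norm_nonneg _) (hw2.trans hrN1)).trans hw1
    rw [Finset.prod_range_succ]
    generalize (∏ k ∈ Finset.range N, ((1 + ‖z‖ * r ^ k) *
        (1 + ‖z‖ ^ 2 / (1 - T) * r ^ k))) = P at *
    generalize ∑ p ∈ (boxed_finite (N + 1) L).toFinset, ‖term a b c d z p‖ = S at *
    generalize ∑ p ∈ (boxed_finite (N + 1) L).toFinset, ‖term c d a b z p‖ = S' at *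
    have hP : 0 ≤ P := (Finset.sum_nonneg fun p _ => norm_nonneg _).trans i1
    generalize ‖pairWeight a b c d z (N + 1)‖ = t at *
    have hα : ‖z‖ * ‖partWeight a b (N + 1)‖ ≤ ‖z‖ * r ^ N :=
      mul_le_mul_of_nonneg_left hw1 (norm_nonneg _)
    have hα0 : 0 ≤ ‖z‖ * ‖partWeight a b (N + 1)‖ := by positivity
    have hβ0 : 0 ≤ ‖z‖ * ‖partWeight c d (N + 1)‖ := by positivity
    generalize ‖z‖ * ‖partWeight a b (N + 1)‖ = α at *
    generalize ‖z‖ * ‖partWeight c d (N + 1)‖ = β at *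
    have ht0 : 0 ≤ t := by rw [← hpair]; positivity
    have hS : S * (1 - t) ≤ P * (1 + ‖z‖ * r ^ N) := by
      have h3 : S ≤ P + α * (P + β * S) := by
        refine h1.trans (add_le_add i1 (mul_le_mul_of_nonneg_left ?_ hα0))
        linarith
      have h4 : α * P ≤ ‖z‖ * r ^ N * P := mul_le_mul_of_nonneg_right hα hP
      rw [← hpair]
      linarith
    have hT1 : 0 < 1 - T := by linarith
    -- From `t ≤ T < 1` and `t ≤ ‖z‖² r^N` follows `1/(1 - t) ≤ 1 + ‖z‖²/(1 - T) · r^N`, which is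
    -- summably close to 1.
    have h5 : 1 ≤ (1 - t) * (1 + ‖z‖ ^ 2 / (1 - T) * r ^ N) := by
      have h6 : t ≤ (1 - t) * (‖z‖ ^ 2 / (1 - T) * r ^ N) := by
        have h7 : t ≤ (1 - T) * (‖z‖ ^ 2 / (1 - T) * r ^ N) := by
          rwa [← mul_assoc, mul_div_cancel₀ _ hT1.ne']
        exact h7.trans (mul_le_mul_of_nonneg_right (by linarith) (by positivity))
      linarith
    have hK : 0 ≤ 1 + ‖z‖ ^ 2 / (1 - T) * r ^ N := by positivity
    have hSt : 0 ≤ S ∨ S < 0 := le_or_gt 0 S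
    rcases hSt with hS0 | hS0
    · calc S ≤ S * ((1 - t) * (1 + ‖z‖ ^ 2 / (1 - T) * r ^ N)) := le_mul_of_one_le_right hS0 h5
        _ = S * (1 - t) * (1 + ‖z‖ ^ 2 / (1 - T) * r ^ N) := by ring
        _ ≤ P * (1 + ‖z‖ * r ^ N) * (1 + ‖z‖ ^ 2 / (1 - T) * r ^ N) :=
          mul_le_mul_of_nonneg_right hS hK
        _ = _ := by ring
    · exact hS0.le.trans (by positivity)

theorem summable_all {a b c d z : ℂ} (ha : ‖a‖ < 1) (hb : ‖b‖ < 1) (hc : ‖c‖ < 1)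
    (hd : ‖d‖ < 1) (hz : ‖a * c * z ^ 2‖ < 1) : Summable (term a b c d z) := by
  obtain ⟨r, hr, ha', hb', hc', hd'⟩ : ∃ r : ℝ, r < 1 ∧ ‖a‖ ≤ r ∧ ‖b‖ ≤ r ∧ ‖c‖ ≤ r ∧ ‖d‖ ≤ r :=
    ⟨max (max ‖a‖ ‖b‖) (max ‖c‖ ‖d‖), by simp [ha, hb, hc, hd], by simp, by simp, by simp, by simp⟩
  have hr0 : 0 ≤ r := (norm_nonneg a).trans ha'
  have hK : 0 ≤ ‖z‖ ^ 2 / (1 - ‖a * c * z ^ 2‖) := div_nonneg (by positivity) (by linarith)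
  refine Summable.of_norm (summable_of_sum_le (c := Real.exp (‖z‖ * (1 - r)⁻¹) *
    Real.exp (‖z‖ ^ 2 / (1 - ‖a * c * z ^ 2‖) * (1 - r)⁻¹)) (fun _ => norm_nonneg _) fun u => ?_)
  set N := u.sup fun p => p.1
  set L := u.sup fun p => length p
  calc ∑ p ∈ u, ‖term a b c d z p‖ ≤
        ∑ p ∈ (boxed_finite N L).toFinset, ‖term a b c d z p‖ := by
          refine Finset.sum_le_sum_of_subset_of_nonneg (fun p hp => ?_) fun _ _ _ => norm_nonneg _
          exact (Set.Finite.mem_toFinset _).2 ⟨fun m hm => (le_size hm).trans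
            (Finset.le_sup (f := fun p : IntPartition => p.1) hp),
            Finset.le_sup (f := fun p : IntPartition => length p) hp⟩
    _ ≤ _ := sum_norm_boxed_le N L hr ha' hb' hc' hd' hz
    _ ≤ _ := by
          rw [Finset.prod_mul_distrib]
          exact mul_le_mul (prod_one_add_geometric_le (norm_nonneg z) hr0 hr N)
            (prod_one_add_geometric_le hK hr0 hr N)
            (Finset.prod_nonneg fun k _ => by positivity) (Real.exp_pos _).le

/-! ### From strict partitions to all partitions -/

/-- Applying the deletion of a part `N + 1` twice returns to the original weight and gives `A_{N+1}
(1 - pairWeight) = A_N + z w A'_N`, with `A'` the exchanged sum and `w` the part weight. The right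
side has the shape of `Psi_succ`. -/
theorem tsum_partsLE_mul_prod (N : ℕ) {a b c d z : ℂ} (h1 : Summable (term a b c d z))
    (h2 : Summable (term c d a b z)) :
    (∑' p : partsLE N, term a b c d z p) *
      ∏ m ∈ Finset.range N, (1 - pairWeight a b c d z (m + 1)) = Psi N a b c d z := by
  induction N generalizing a b c d with
  | zero => rw [partsLE_zero, tsum_singleton]; simp [term_emptyPart, Psi_zero]
  | succ N ih =>
    have hrec : ∀ {a b c d : ℂ}, Summable (term a b c d z) →
        ∑' p : partsLE (N + 1), term a b c d z p = ∑' p : partsLE N, term a b c d z p +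
          z * partWeight a b (N + 1) * ∑' p : partsLE (N + 1), term c d a b z p := by
      intro a b c d h
      rw [tsum_partsLE_succ h, ← tsum_mul_left]
      congr 1
      exact tsum_congr fun p => term_consPart a b c d z p.2
    have e1 := hrec h1
    have e2 := hrec h2
    have hswap : ∏ m ∈ Finset.range N, (1 - pairWeight c d a b z (m + 1)) =
        ∏ m ∈ Finset.range N, (1 - pairWeight a b c d z (m + 1)) :=
      Finset.prod_congr rfl fun m _ => by rw [pairWeight, pairWeight]; ring
    have i1 := ih h1 h2
    have i2 := ih h2 h1
    rw [hswap] at i2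
    rw [Psi_succ, Finset.prod_range_succ, ← i1, ← i2, pairWeight]
    linear_combination (∏ m ∈ Finset.range N, (1 - pairWeight a b c d z (m + 1))) *
      (e1 + z * partWeight a b (N + 1) * e2)

theorem prod_pairWeight (N : ℕ) (a b c d z : ℂ) :
    ∏ m ∈ Finset.range (2 * N), (1 - pairWeight a b c d z (m + 1)) =
      qFac (a * c * z ^ 2) (a * b * c * d) N *
        qFac (z ^ 2 * (a * b * c * d)) (a * b * c * d) N := by
  induction N with
  | zero => simp [qFac_zero]
  | succ N ih =>
    rw [show 2 * (N + 1) = 2 * N + 1 + 1 by ring, Finset.prod_range_succ, Finset.prod_range_succ,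
      ih, pairWeight_odd, show 2 * N + 1 + 1 = 2 * (N + 1) by ring, pairWeight_even, qFac_succ,
      qFac_succ, pow_succ]
    ring

theorem tendsto_tsum_partsLE {F : IntPartition → ℂ} (hF : Summable F) :
    Tendsto (fun N => ∑' p : partsLE N, F p) atTop (𝓝 (∑' p, F p)) := by
  simp only [tsum_subtype]
  refine tendsto_tsum_of_dominated_convergence hF.norm (fun p => ?_)
    (Eventually.of_forall fun N p => norm_indicator_le_norm_self _ _)
  refine tendsto_const_nhds.congr' ?_
  filter_upwards [eventually_ge_atTop p.1] with N hN
  rw [Set.indicator_of_mem]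
  exact fun m hm => (le_size hm).trans hN

theorem tsum_all_mul {a b c d z : ℂ} (ha : ‖a‖ < 1) (hb : ‖b‖ < 1) (hc : ‖c‖ < 1)
    (hd : ‖d‖ < 1) (hq : ‖a * b * c * d‖ < 1) (hz : ‖a * c * z ^ 2‖ < 1) :
    (∑' p, term a b c d z p) * (qFacInf (a * c * z ^ 2) (a * b * c * d) *
      qFacInf (z ^ 2 * (a * b * c * d)) (a * b * c * d)) =
    ∑' μ : StrictPartition, weight a b c d μ.1 * z ^ length μ.1 := by
  have h1 := summable_all ha hb hc hd hz
  have h2 := summable_all hc hd ha hb (by rwa [mul_comm c a])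
  -- Along even bounds the product splits exactly into two shifted factorials: odd parts give
  -- `(acz²;q)_N`, even parts `(z²q;q)_N`.
  have h2N : Tendsto (fun N : ℕ => 2 * N) atTop atTop :=
    tendsto_id.const_mul_atTop' (by norm_num)
  have hl := ((tendsto_tsum_partsLE h1).comp h2N).mul ((tendsto_qFac (a * c * z ^ 2) hq).mul
    (tendsto_qFac (z ^ 2 * (a * b * c * d)) hq))
  refine tendsto_nhds_unique (hl.congr fun N => ?_) ((tendsto_Psi ha hb hc hd z).comp h2N)
  rw [← prod_pairWeight]
  exact tsum_partsLE_mul_prod (2 * N) h1 h2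

/-! ### Expansion by the number of parts -/

/-- The weight of `p` if it has `j` parts, and `0` otherwise. -/
noncomputable def weightOfLength (j : ℕ) (a b c d : ℂ) (p : IntPartition) : ℂ :=
  if length p = j then weight a b c d p else 0

/-- The coefficient of `z ^ j` in `Ψ_N`. -/
noncomputable def psiCoeff (j N : ℕ) (a b c d : ℂ) : ℂ :=
  ∑ p ∈ (strictLE_finite N).toFinset, weightOfLength j a b c d p

theorem weight_emptyPart (a b c d : ℂ) : weight a b c d emptyPart = 1 := by
  simp [weight, length, emptyPart, ofParts]

theorem length_emptyPart : length emptyPart = 0 := by simp [length, emptyPart, ofParts]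

theorem psiCoeff_zero_right (j : ℕ) (a b c d : ℂ) :
    psiCoeff j 0 a b c d = if j = 0 then 1 else 0 := by
  rw [psiCoeff, sum_strictLE_zero, weightOfLength, weight_emptyPart, length_emptyPart]
  simp [eq_comm]

theorem psiCoeff_zero_left (N : ℕ) (a b c d : ℂ) : psiCoeff 0 N a b c d = 1 := by
  induction N with
  | zero => simp [psiCoeff_zero_right]
  | succ N ih =>
    rw [psiCoeff, sum_strictLE_succ, ← psiCoeff, ih]
    simp [weightOfLength, length_consPart]

theorem psiCoeff_succ (j N : ℕ) (a b c d : ℂ) :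
    psiCoeff (j + 1) (N + 1) a b c d =
      psiCoeff (j + 1) N a b c d + partWeight a b (N + 1) * psiCoeff j N c d a b := by
  rw [psiCoeff, sum_strictLE_succ, psiCoeff, psiCoeff, Finset.mul_sum]
  congr 1
  refine Finset.sum_congr rfl fun p hp => ?_
  rw [weightOfLength, weightOfLength, length_consPart, weight_consPart a b c d fun i hi =>
    (((Set.Finite.mem_toFinset _).1 hp).2 i hi).trans N.le_succ]
  simp

theorem partWeight_add_two (a b : ℂ) (m : ℕ) :
    partWeight a b (m + 2) = a * b * partWeight a b m := by
  rw [partWeight, partWeight, show (m + 2 + 1) / 2 = (m + 1) / 2 + 1 by omega,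
    show (m + 2) / 2 = m / 2 + 1 by omega, pow_succ, pow_succ]
  ring

theorem partWeight_one (a b : ℂ) : partWeight a b 1 = a := by simp [partWeight]

theorem partWeight_two (a b : ℂ) : partWeight a b 2 = a * b := by simp [partWeight]

/-- This and the next two relations classify by which of the parts 1 and 2 occur. The remaining
parts are lowered by 2, which costs `ab` at an odd place and `cd` at an even one. The formal proof
is an induction on the largest part, using the preceding relation with the pairs exchanged. -/
theorem psiCoeff_one_add_two (N : ℕ) (a b c d : ℂ) :
    psiCoeff 1 (N + 2) a b c d = a * b * psiCoeff 1 N a b c d + a * (1 + b) := by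
  induction N with
  | zero =>
    rw [psiCoeff_succ, psiCoeff_succ]
    simp only [psiCoeff_zero_left, psiCoeff_zero_right, zero_add, partWeight_one,
      partWeight_two, one_ne_zero, if_false, if_true, Nat.reduceAdd]
    ring
  | succ N ih =>
    rw [show N + 1 + 2 = N + 2 + 1 by ring, psiCoeff_succ, ih, psiCoeff_succ 0 N,
      show N + 2 + 1 = N + 1 + 2 by ring, partWeight_add_two, psiCoeff_zero_left,
      psiCoeff_zero_left]
    ring

theorem psiCoeff_two_add_two (N : ℕ) (a b c d : ℂ) :
    psiCoeff 2 (N + 2) a b c d = a * b * c * d * psiCoeff 2 N a b c d +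
      c * (1 + d) * (a * b) * psiCoeff 1 N a b c d + a * b * c := by
  induction N with
  | zero =>
    rw [psiCoeff_succ, psiCoeff_succ, psiCoeff_succ]
    simp only [psiCoeff_zero_right, zero_add, partWeight_one, partWeight_two, one_ne_zero,
      if_false, if_true, Nat.reduceAdd, OfNat.ofNat_ne_zero]
    ring
  | succ N ih =>
    rw [show N + 1 + 2 = N + 2 + 1 by ring, psiCoeff_succ, ih, psiCoeff_succ 1 N,
      psiCoeff_succ 0 N, show N + 2 + 1 = N + 1 + 2 by ring, partWeight_add_two,
      psiCoeff_zero_left, psiCoeff_one_add_two]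
    ring

theorem psiCoeff_three_add_two (N : ℕ) (a b c d : ℂ) :
    psiCoeff 3 (N + 2) a b c d = a * b * c * d * (a * b) * psiCoeff 3 N a b c d +
      a * (1 + b) * (a * b * c * d) * psiCoeff 2 N a b c d +
      a * c * d * (a * b) * psiCoeff 1 N a b c d := by
  induction N with
  | zero =>
    rw [psiCoeff_succ, psiCoeff_succ, psiCoeff_succ]
    simp only [psiCoeff_zero_right, zero_add, one_ne_zero, if_false, Nat.reduceAdd,
      OfNat.ofNat_ne_zero]
    ring
  | succ N ih =>
    rw [show N + 1 + 2 = N + 2 + 1 by ring, psiCoeff_succ, ih, psiCoeff_succ 2 N,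
      psiCoeff_succ 1 N, psiCoeff_succ 0 N, show N + 2 + 1 = N + 1 + 2 by ring,
      partWeight_add_two, psiCoeff_zero_left, psiCoeff_two_add_two]
    ring

/-- The coefficient of `z ^ j` in the generating function of the strict partitions. -/
noncomputable def strictCoeff (j : ℕ) (a b c d : ℂ) : ℂ :=
  ∑' μ : StrictPartition, weightOfLength j a b c d μ.1

section

variable {a b c d : ℂ}

theorem summable_weight (ha : ‖a‖ < 1) (hb : ‖b‖ < 1) (hc : ‖c‖ < 1) (hd : ‖d‖ < 1) :
    Summable fun μ : StrictPartition => weight a b c d μ.1 := by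
  simpa [term] using summable_strict ha hb hc hd 1

theorem summable_weightOfLength (ha : ‖a‖ < 1) (hb : ‖b‖ < 1) (hc : ‖c‖ < 1) (hd : ‖d‖ < 1)
    (j : ℕ) : Summable fun μ : StrictPartition => weightOfLength j a b c d μ.1 := by
  refine Summable.of_norm_bounded (summable_weight ha hb hc hd).norm fun μ => ?_
  rw [weightOfLength]
  split_ifs <;> simp

theorem tendsto_psiCoeff (ha : ‖a‖ < 1) (hb : ‖b‖ < 1) (hc : ‖c‖ < 1) (hd : ‖d‖ < 1) (j : ℕ) :
    Tendsto (fun N => psiCoeff j N a b c d) atTop (𝓝 (strictCoeff j a b c d)) :=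
  tendsto_sum_strictLE (summable_weightOfLength ha hb hc hd j)

theorem strictCoeff_zero (ha : ‖a‖ < 1) (hb : ‖b‖ < 1) (hc : ‖c‖ < 1) (hd : ‖d‖ < 1) :
    strictCoeff 0 a b c d = 1 := by
  refine tendsto_nhds_unique (tendsto_psiCoeff ha hb hc hd 0) ?_
  simp [psiCoeff_zero_left]

theorem strictCoeff_one (ha : ‖a‖ < 1) (hb : ‖b‖ < 1) (hc : ‖c‖ < 1) (hd : ‖d‖ < 1) :
    (1 - a * b) * strictCoeff 1 a b c d = a * (1 + b) := by
  have h1 := tendsto_psiCoeff ha hb hc hd 1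
  have := tendsto_nhds_unique ((h1.comp (tendsto_add_atTop_nat 2)).congr
    fun N => psiCoeff_one_add_two N a b c d) ((h1.const_mul (a * b)).add_const (a * (1 + b)))
  linear_combination this

theorem strictCoeff_two (ha : ‖a‖ < 1) (hb : ‖b‖ < 1) (hc : ‖c‖ < 1) (hd : ‖d‖ < 1) :
    (1 - a * b * c * d) * strictCoeff 2 a b c d =
      c * (1 + d) * (a * b) * strictCoeff 1 a b c d + a * b * c := by
  have h1 := tendsto_psiCoeff ha hb hc hd 1
  have h2 := tendsto_psiCoeff ha hb hc hd 2
  have := tendsto_nhds_unique ((h2.comp (tendsto_add_atTop_nat 2)).congr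
    fun N => psiCoeff_two_add_two N a b c d) (((h2.const_mul (a * b * c * d)).add
      (h1.const_mul (c * (1 + d) * (a * b)))).add_const (a * b * c))
  linear_combination this

theorem strictCoeff_three (ha : ‖a‖ < 1) (hb : ‖b‖ < 1) (hc : ‖c‖ < 1) (hd : ‖d‖ < 1) :
    (1 - a * b * c * d * (a * b)) * strictCoeff 3 a b c d =
      a * (1 + b) * (a * b * c * d) * strictCoeff 2 a b c d +
        a * c * d * (a * b) * strictCoeff 1 a b c d := by
  have h1 := tendsto_psiCoeff ha hb hc hd 1
  have h2 := tendsto_psiCoeff ha hb hc hd 2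
  have h3 := tendsto_psiCoeff ha hb hc hd 3
  have := tendsto_nhds_unique ((h3.comp (tendsto_add_atTop_nat 2)).congr
    fun N => psiCoeff_three_add_two N a b c d) (((h3.const_mul (a * b * c * d * (a * b))).add
      (h2.const_mul (a * (1 + b) * (a * b * c * d)))).add (h1.const_mul (a * c * d * (a * b))))
  linear_combination this

/-- For `|z| < 1` every partition with at least `n` parts contributes at most `|ω(μ)| |z|^n`, and
the weights are absolutely summable. -/
theorem strict_sub_isBigO (ha : ‖a‖ < 1) (hb : ‖b‖ < 1) (hc : ‖c‖ < 1) (hd : ‖d‖ < 1) (n : ℕ) :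
    (fun z : ℂ => (∑' μ : StrictPartition, weight a b c d μ.1 * z ^ length μ.1) -
      ∑ j ∈ Finset.range n, strictCoeff j a b c d * z ^ j) =O[𝓝 0] fun z : ℂ => z ^ n := by
  refine Asymptotics.IsBigO.of_bound (∑' μ : StrictPartition, ‖weight a b c d μ.1‖) ?_
  filter_upwards [Metric.ball_mem_nhds (0 : ℂ) one_pos] with z hz
  rw [mem_ball_zero_iff] at hz
  have hs := (summable_strict ha hb hc hd z).hasSum.sub (hasSum_sum (s := Finset.range n)
    fun j _ => (summable_weightOfLength ha hb hc hd j).hasSum.mul_right (z ^ j))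
  have hsn := (summable_weight ha hb hc hd).norm
  change ‖(∑' μ : StrictPartition, term a b c d z μ.1) -
    ∑ j ∈ Finset.range n, (∑' μ : StrictPartition, weightOfLength j a b c d μ.1) * z ^ j‖ ≤ _
  rw [← hs.tsum_eq, ← tsum_mul_right]
  refine tsum_of_norm_bounded (hsn.mul_right _).hasSum fun μ => ?_
  have hterm : ∑ j ∈ Finset.range n, weightOfLength j a b c d μ.1 * z ^ j =
      if length μ.1 < n then term a b c d z μ.1 else 0 := by
    simp only [weightOfLength, ite_mul, zero_mul, Finset.sum_ite_eq, Finset.mem_range, term]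
  rw [hterm]
  split_ifs with h
  · rw [sub_self, norm_zero]; positivity
  · rw [sub_zero, term, norm_mul, norm_pow, norm_pow]
    exact mul_le_mul_of_nonneg_left
      (pow_le_pow_of_le_one (norm_nonneg _) hz.le (not_lt.1 h)) (norm_nonneg _)

/-! ### The generating functions of the strict partitions -/

theorem norm_abcd_lt_one (ha : ‖a‖ < 1) (hb : ‖b‖ < 1) (hc : ‖c‖ < 1) (hd : ‖d‖ < 1) :
    ‖a * b‖ < 1 ∧ ‖a * b * c‖ < 1 ∧ ‖a * b * c * d‖ < 1 := by
  have h1 : ‖a * b‖ < 1 := by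
    rw [norm_mul]; exact mul_lt_one_of_nonneg_of_lt_one_left (norm_nonneg _) ha hb.le
  have h2 : ‖a * b * c‖ < 1 := by
    rw [norm_mul]; exact mul_lt_one_of_nonneg_of_lt_one_left (norm_nonneg _) h1 hc.le
  refine ⟨h1, h2, ?_⟩
  rw [norm_mul]; exact mul_lt_one_of_nonneg_of_lt_one_left (norm_nonneg _) h2 hd.le

theorem tsum_strict_eq_X (ha : ‖a‖ < 1) (hb : ‖b‖ < 1) (hc : ‖c‖ < 1) (hd : ‖d‖ < 1) {z : ℂ}
    (hz : ∀ k : ℕ, 1 ≤ k → 1 + a * z ^ 2 * (a * b * c * d) ^ k ≠ 0) :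
    ∑' μ : StrictPartition, weight a b c d μ.1 * z ^ length μ.1 =
      qFacInf (-(a * b * c)) (a * b * c * d) *
        qFacInf (-(a * z ^ 2 * (a * b * c * d))) (a * b * c * d) /
          qFacInf (a * b) (a * b * c * d) *
        (sX0 a b c d z * X 1 a b c d z - sX1 a b c d z * X 0 a b c d z) := by
  obtain ⟨hab, habc, hq⟩ := norm_abcd_lt_one ha hb hc hd
  -- The parameters are read off from the recurrence: `C + x u = -a(1 + bc) z² q` and `β - ρ q^N =
  -- ab(1 - acz² q^N)`.
  have h := limit_of_recurrence (V := fun N => X N a b c d z) (u := z ^ 2 * (a * b * c * d))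
    (B := -(a * b * d)) (C := -(a * z ^ 2 * (a * b * c * d))) (x := -(a * b * c)) (β := a * b)
    (ρ := a ^ 2 * b * c * z ^ 2) hq (by rwa [norm_neg]) (by ring) (by ring)
    (fun k => by
      have := hz (k + 1) (by omega)
      rw [neg_mul, sub_neg_eq_add]
      rwa [show a * z ^ 2 * (a * b * c * d) * (a * b * c * d) ^ k =
        a * z ^ 2 * (a * b * c * d) ^ (k + 1) by ring])
    (fun N => by rw [X_recurrence]; ring)
    ((tendsto_Psi ha hb hc hd z).comp (tendsto_id.const_mul_atTop' (by norm_num)))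
  rw [div_mul_eq_mul_div, eq_div_iff (qFacInf_ne_zero hq hab), h]
  simp only [sX0, sX1]
  rw [show z ^ 2 * (a * b * c * d) * (a * b * c * d) = z ^ 2 * (a * b * c * d) ^ 2 by ring,
    show -(a * z ^ 2 * (a * b * c * d)) * (a * b * c * d) = -(a * z ^ 2 * (a * b * c * d) ^ 2) by
      ring, sub_neg_eq_add]
  ring

theorem tsum_strict_eq_Y (ha : ‖a‖ < 1) (hb : ‖b‖ < 1) (hc : ‖c‖ < 1) (hd : ‖d‖ < 1) {z : ℂ}
    (hz : ∀ k : ℕ, 2 ≤ k → 1 + a * z ^ 2 * (a * b * c * d) ^ k ≠ 0) :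
    ∑' μ : StrictPartition, weight a b c d μ.1 * z ^ length μ.1 =
      qFacInf (-(a * b * c)) (a * b * c * d) *
        qFacInf (-(a * z ^ 2 * (a * b * c * d) ^ 2)) (a * b * c * d) /
          qFacInf (a * b) (a * b * c * d) *
        (sY0 a b c d z * Y 1 a b c d z - sY1 a b c d z * Y 0 a b c d z) := by
  obtain ⟨hab, habc, hq⟩ := norm_abcd_lt_one ha hb hc hd
  -- Compared with `X`, only `C` and `ρ` gain a factor `q`, so the nonvanishing condition starts at
  -- exponent 2.
  have h := limit_of_recurrence (V := fun N => Y N a b c d z) (u := z ^ 2 * (a * b * c * d))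
    (B := -(a * b * d)) (C := -(a * (a * b * c * d) ^ 2 * z ^ 2)) (x := -(a * b * c))
    (β := a * b) (ρ := a ^ 2 * b * c * (a * b * c * d) * z ^ 2) hq (by rwa [norm_neg]) (by ring)
    (by ring)
    (fun k => by
      have := hz (k + 2) (by omega)
      rw [neg_mul, sub_neg_eq_add]
      rwa [show a * (a * b * c * d) ^ 2 * z ^ 2 * (a * b * c * d) ^ k =
        a * z ^ 2 * (a * b * c * d) ^ (k + 2) by ring])
    (fun N => by rw [Y_recurrence]; ring)
    ((tendsto_Psi ha hb hc hd z).comp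
      ((tendsto_add_atTop_nat 1).comp (tendsto_id.const_mul_atTop' (by norm_num))))
  rw [div_mul_eq_mul_div, eq_div_iff (qFacInf_ne_zero hq hab), h]
  simp only [sY0, sY1]
  rw [show z ^ 2 * (a * b * c * d) * (a * b * c * d) = z ^ 2 * (a * b * c * d) ^ 2 by ring,
    show -(a * (a * b * c * d) ^ 2 * z ^ 2) * (a * b * c * d) =
      -(a * (a * b * c * d) ^ 3 * z ^ 2) by ring,
    show -(a * z ^ 2 * (a * b * c * d) ^ 2) = -(a * (a * b * c * d) ^ 2 * z ^ 2) by ring,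
    sub_neg_eq_add]
  ring

/-! ### The generating function of all partitions -/

theorem norm_sq_mul_lt_one (hb : ‖b‖ < 1) (hd : ‖d‖ < 1) {z : ℂ} (hz : ‖a * c * z ^ 2‖ < 1) :
    ‖z ^ 2 * (a * b * c * d)‖ < 1 := by
  rw [show z ^ 2 * (a * b * c * d) = a * c * z ^ 2 * (b * d) by ring, norm_mul, norm_mul b]
  exact mul_lt_one_of_nonneg_of_lt_one_left (norm_nonneg _) hz
    (mul_le_one₀ hb.le (norm_nonneg _) hd.le)

/-- When `|acz²| < 1`, also `|az²q| < 1`, so the nonvanishing conditions of (2) and (3) hold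
automatically in (5). -/
theorem one_add_ne_zero (ha : ‖a‖ < 1) (hb : ‖b‖ < 1) (hc : ‖c‖ < 1) (hd : ‖d‖ < 1) {z : ℂ}
    (hz : ‖a * c * z ^ 2‖ < 1) (k : ℕ) (hk : 1 ≤ k) :
    1 + a * z ^ 2 * (a * b * c * d) ^ k ≠ 0 := by
  obtain ⟨k, rfl⟩ := Nat.exists_eq_add_of_le hk
  have h1 : ‖-(a * (z ^ 2 * (a * b * c * d)))‖ < 1 := by
    rw [norm_neg, norm_mul]
    exact mul_lt_one_of_nonneg_of_lt_one_left (norm_nonneg _) ha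
      (norm_sq_mul_lt_one hb hd hz).le
  have h2 := one_sub_mul_pow_ne_zero h1 (norm_abcd_lt_one ha hb hc hd).2.2 k
  rwa [neg_mul, sub_neg_eq_add, show a * (z ^ 2 * (a * b * c * d)) * (a * b * c * d) ^ k =
    a * z ^ 2 * (a * b * c * d) ^ (1 + k) by ring] at h2

theorem hasSum_all_of_strict (ha : ‖a‖ < 1) (hb : ‖b‖ < 1) (hc : ‖c‖ < 1) (hd : ‖d‖ < 1) {z : ℂ}
    (hz : ‖a * c * z ^ 2‖ < 1) {P Q S : ℂ}
    (h : ∑' μ : StrictPartition, weight a b c d μ.1 * z ^ length μ.1 = P / Q * S) :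
    HasSum (fun p : IntPartition => weight a b c d p * z ^ length p)
      (P / (Q * qFacInf (a * c * z ^ 2) (a * b * c * d) *
        qFacInf (z ^ 2 * (a * b * c * d)) (a * b * c * d)) * S) := by
  have hq := (norm_abcd_lt_one ha hb hc hd).2.2
  have h1 := qFacInf_ne_zero hq hz
  have h2 := qFacInf_ne_zero hq (norm_sq_mul_lt_one hb hd hz)
  have key := tsum_all_mul ha hb hc hd hq hz
  have : P / (Q * qFacInf (a * c * z ^ 2) (a * b * c * d) *
        qFacInf (z ^ 2 * (a * b * c * d)) (a * b * c * d)) * S = ∑' p, term a b c d z p := by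
    rw [mul_assoc Q, ← div_div, div_mul_eq_mul_div, div_eq_iff (mul_ne_zero h1 h2), key, h]
  rw [this]
  exact (summable_all ha hb hc hd hz).hasSum

end

end AndrewsStanley

/-! ### Assembly of the five statements -/

open AndrewsStanley
theorem mainTheorem6 (a b c d q : ℂ) (ha : ‖a‖ < 1) (hb : ‖b‖ < 1) (hc : ‖c‖ < 1) (hd : ‖d‖ < 1)
    (hq : q = a * b * c * d) :
    (∀ z : ℂ, Summable fun μ : StrictPartition =>
      weight a b c d μ.1 * z ^ length μ.1) ∧
    (∀ z : ℂ, (∀ k : ℕ, 1 ≤ k → 1 + a * z ^ 2 * q ^ k ≠ 0) →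
      ∑' μ : StrictPartition, weight a b c d μ.1 * z ^ length μ.1 =
        qFacInf (-(a * b * c)) q * qFacInf (-(a * z ^ 2 * q)) q / qFacInf (a * b) q *
          (sX0 a b c d z * X 1 a b c d z - sX1 a b c d z * X 0 a b c d z)) ∧
    (∀ z : ℂ, (∀ k : ℕ, 2 ≤ k → 1 + a * z ^ 2 * q ^ k ≠ 0) →
      ∑' μ : StrictPartition, weight a b c d μ.1 * z ^ length μ.1 =
        qFacInf (-(a * b * c)) q * qFacInf (-(a * z ^ 2 * q ^ 2)) q / qFacInf (a * b) q *
          (sY0 a b c d z * Y 1 a b c d z - sY1 a b c d z * Y 0 a b c d z)) ∧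
    ((fun z : ℂ =>
        (∑' μ : StrictPartition, weight a b c d μ.1 * z ^ length μ.1) -
        (1 + a * (1 + b) / (1 - a * b) * z +
          a * b * c * (1 + a + a * d + a * b * d) / ((1 - a * b) * (1 - q)) * z ^ 2 +
          a ^ 2 * q * (1 + b) * (1 + b * c + a * b * c + b * q) /
            ((1 - a * b) * (1 - q) * (1 - a * b * q)) * z ^ 3))
      =O[nhds 0] fun z : ℂ => z ^ 4) ∧
    (∀ z : ℂ, ‖a * c * z ^ 2‖ < 1 →
      HasSum (fun p : IntPartition => weight a b c d p * z ^ length p)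
        (qFacInf (-(a * b * c)) q * qFacInf (-(a * z ^ 2 * q)) q /
            (qFacInf (a * b) q * qFacInf (a * c * z ^ 2) q * qFacInf (z ^ 2 * q) q) *
          (sX0 a b c d z * X 1 a b c d z - sX1 a b c d z * X 0 a b c d z)) ∧
      HasSum (fun p : IntPartition => weight a b c d p * z ^ length p)
        (qFacInf (-(a * b * c)) q * qFacInf (-(a * z ^ 2 * q ^ 2)) q /
            (qFacInf (a * b) q * qFacInf (a * c * z ^ 2) q * qFacInf (z ^ 2 * q) q) *
          (sY0 a b c d z * Y 1 a b c d z - sY1 a b c d z * Y 0 a b c d z))) := by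
  subst hq
  obtain ⟨hab, habc, hq⟩ := norm_abcd_lt_one ha hb hc hd
  refine ⟨summable_strict ha hb hc hd, fun z hz => tsum_strict_eq_X ha hb hc hd hz,
    fun z hz => tsum_strict_eq_Y ha hb hc hd hz, ?_, fun z hz =>
    ⟨hasSum_all_of_strict ha hb hc hd hz
      (tsum_strict_eq_X ha hb hc hd (one_add_ne_zero ha hb hc hd hz)),
    hasSum_all_of_strict ha hb hc hd hz
      (tsum_strict_eq_Y ha hb hc hd fun k hk =>
        one_add_ne_zero ha hb hc hd hz k (one_le_two.trans hk))⟩⟩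
  have n1 : 1 - a * b ≠ 0 := by simpa using one_sub_mul_pow_ne_zero hab hq 0
  have n2 : 1 - a * b * c * d ≠ 0 := by simpa using one_sub_mul_pow_ne_zero hq hq 0
  have n3 : 1 - a * b * (a * b * c * d) ≠ 0 := by simpa using one_sub_mul_pow_ne_zero hab hq 1
  -- The limiting relations are triangular in the number of parts, so the coefficients are solved
  -- successively after clearing denominators.
  have e1 : strictCoeff 1 a b c d = a * (1 + b) / (1 - a * b) := by
    rw [eq_div_iff n1]
    linear_combination strictCoeff_one ha hb hc hd
  have e2 : strictCoeff 2 a b c d = a * b * c * (1 + a + a * d + a * b * d) /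
      ((1 - a * b) * (1 - a * b * c * d)) := by
    rw [eq_div_iff (mul_ne_zero n1 n2)]
    linear_combination (1 - a * b) * strictCoeff_two ha hb hc hd +
      c * (1 + d) * (a * b) * strictCoeff_one ha hb hc hd
  have e3 : strictCoeff 3 a b c d = a ^ 2 * (a * b * c * d) * (1 + b) *
      (1 + b * c + a * b * c + b * (a * b * c * d)) /
      ((1 - a * b) * (1 - a * b * c * d) * (1 - a * b * (a * b * c * d))) := by
    rw [eq_div_iff (mul_ne_zero (mul_ne_zero n1 n2) n3)]
    have h2 := (eq_div_iff (mul_ne_zero n1 n2)).1 e2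
    linear_combination (1 - a * b) * (1 - a * b * c * d) * strictCoeff_three ha hb hc hd +
      a * (1 + b) * (a * b * c * d) * h2 +
      a * c * d * (a * b) * (1 - a * b * c * d) * strictCoeff_one ha hb hc hd
  refine (strict_sub_isBigO ha hb hc hd 4).congr_left fun z => ?_
  simp only [Finset.sum_range_succ, Finset.sum_range_zero, strictCoeff_zero ha hb hc hd, e1, e2,
    e3]
  ring
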